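/- **Setting.** Let $\nu\in\mathbb C$. *Deligne's category.* For $r,s\ge 0$ let $P_{r,s}$ be the set of partitions of the set $\{1,\dots,r,1',\dots,s'\}$. Consider the $\mathbb C$-linear category with objects $\mathfrak h^{\otimes r}$ ($r\ge0$), with $\mathrm{Hom}(\mathfrak h^{\otimes r},\mathfrak h^{\otimes s})=\mathbb C P_{r,s}$, and with composition $\rho\circ\pi=\nu^{n(\rho,\pi)}\,\rho\star\pi$ for $\pi\in P_{r,s}$, $\rho\in P_{s,t}$: glue the diagrams of $\pi$ and $\rho$ along the row of length $s$; $\rho\star\pi\in P_{r,t}$ is the partition of the two outer rows into connected components, and $n(\rho,\pi)$ is the number of connected components contained in the middle row. $\underline{Rep}(S_\nu)$ is the Karoubi envelope of the additive envelope of this category, and $Ind\text{-}\underline{Rep}(S_\nu)$ is its ind-completion with the induced $\mathbb C$-linear structure. *The objects $\Delta_k$.* For $\pi\in P_{r,s}$ define $x_\pi\in\mathbb CP_{r,s}$ by $\pi=\sum_{\tau}x_\tau$, the sum over all $\tau\in P_{r,s}$ equal to or coarser than $\pi$. The element $x_{\mathrm{id}_k}\in\mathbb CP_{k,k}$, where $\mathrm{id}_k=\{\{i,i'\}\}_i$,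 is idempotent, and $\Delta_k\in\underline{Rep}(S_\nu)$ is its image. Each partition $\pi\in P_{r,s}$ in which no two elements of the same row lie in one part gives a morphism $x_\pi:\Delta_r\to\Delta_s$. In this way define: * $res_l:\Delta_{k+1}\to\Delta_k$ ($1\le l\le k+1$), given by the partition in which the top vertex $l$ is solitary and the other top vertices are joined in increasing order to the $k$ bottom vertices; * $res_l^*:\Delta_k\to\Delta_{k+1}$, given by the mirror image of that partition; * the action of $\sigma\in S_k$ on $\Delta_k$, given by the partition $\{\{i,\sigma(i)'\}\}_i$. *The complex tensor power.* Let $V$ be a finite-dimensional complex vector space, $\mathbf 1\in V$ a non-zero vector and $V=\mathbb C\mathbf 1\oplus U$ a splitting. Let $S_k$ act on $U^{\otimes k}\otimes\Delta_k$ diagonally, and put $$V^{\underline\otimes\nu}:=\bigoplus_{k\ge0}(U^{\otimes k}\otimes\Delta_k)^{S_k}\in Ind\text{-}\underline{Rep}(S_\nu).$$ For $u\in U$, $f\in U^*$, $A\in\mathfrak{gl}(U)$ let $u^{(l)}:U^{\otimes k}\to U^{\otimes k+1}$ insert $u$ as the $l$-th factor, let $f^{(l)}:U^{\otimes k+1}\to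 U^{\otimes k}$ apply $f$ to the $l$-th factor, and let $A^{(i)}:U^{\otimes k}\to U^{\otimes k}$ apply $A$ to the $i$-th factor. Put $$F_u:=\frac1{k+1}\sum_{l=1}^{k+1}u^{(l)}\otimes res_l^*:\ U^{\otimes k}\otimes\Delta_k\to U^{\otimes k+1}\otimes\Delta_{k+1},$$ $$E_f:=\sum_{l=1}^{k+1}f^{(l)}\otimes res_l:\ U^{\otimes k+1}\otimes\Delta_{k+1}\to U^{\otimes k}\otimes\Delta_k,\qquad \sum_{i=1}^kA^{(i)}\otimes\mathrm{id}_{\Delta_k}:\ U^{\otimes k}\otimes\Delta_k\to U^{\otimes k}\otimes\Delta_k .$$ Identify $U$, $U^*$ and $\mathfrak{gl}(U)$ with subspaces of $\mathfrak{gl}(V)$: $u\in U$ is the operator $\mathbf 1\mapsto u$, $U\mapsto 0$; $f\in U^*$ is the operator $\mathbf 1\mapsto0$, $w\mapsto f(w)\mathbf 1$ for $w\in U$; and $A\in\mathfrak{gl}(U)$ is extended by $\mathbf 1\mapsto 0$. **Lemma.** 1. For all $k\ge0$, $u\in U$, $f\in U^*$, $A\in\mathfrak{gl}(U)$ the morphisms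 $F_u$, $E_f$ and $\sum_iA^{(i)}\otimes\mathrm{id}_{\Delta_k}$ restrict to morphisms $$(U^{\otimes k}\otimes\Delta_k)^{S_k}\to(U^{\otimes k+1}\otimes\Delta_{k+1})^{S_{k+1}},\quad (U^{\otimes k+1}\otimes\Delta_{k+1})^{S_{k+1}}\to(U^{\otimes k}\otimes\Delta_k)^{S_k},\quad (U^{\otimes k}\otimes\Delta_k)^{S_k}\to(U^{\otimes k}\otimes\Delta_k)^{S_k}.$$ 2. With $E_f:=0$ on the summand $k=0$, one has on $(U^{\otimes k}\otimes\Delta_k)^{S_k}$, for every $k\ge0$, $$E_f F_u-F_uE_f=(\nu-k)\,f(u)\,\mathrm{id}-\sum_{i=1}^kT_{f,u}^{(i)}\otimes\mathrm{id}_{\Delta_k},\qquad T_{f,u}(w):=f(w)u .$$ 3. There is exactly one homomorphism of complex Lie algebras $\mathfrak{gl}(V)\to\mathrm{End}_{Ind\text{-}\underline{Rep}(S_\nu)}(V^{\underline\otimes\nu})$ under which $\mathrm{id}_V$ acts by the scalar $\nu$ and, for all $u\in U$, $f\in U^*$, $A\in\mathfrak{gl}(U)$, the element $u$ acts on each summand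 by $F_u$, the element $f$ acts by $E_f$ on the summands with $k\ge1$ and by $0$ on the summand $k=0$, and $A$ acts on the $k$-th summand by $\sum_iA^{(i)}\otimes\mathrm{id}_{\Delta_k}$. That is, the formulas give a well-defined $\mathfrak{gl}(V)$-action on $V^{\underline\otimes\nu}$. -/

import Mathlib

noncomputable section

namespace DeligneSn

open CategoryTheory Limits

/-- A partition of the set `{1, ..., r, 1', ..., s'}` (`Sum.inl` is the top row, `Sum.inr` the bottom
row), given as an equivalence relation. In the order of `Setoid`, `π ≤ τ` means that `τ` is
coarser than `π`. -/
abbrev Diagram (r s : ℕ) : Type := Setoid (Fin r ⊕ Fin s)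

instance (r s : ℕ) : Finite (Diagram r s) :=
  Finite.of_injective (fun π : Diagram r s => fun x y => π x y)
    (fun _ _ h => Setoid.ext fun x y => by simpa using congrFun (congrFun h x) y)

instance (r s : ℕ) : Fintype (Diagram r s) := Fintype.ofFinite _

open scoped Classical in
instance (r s : ℕ) : LocallyFiniteOrder (Diagram r s) := Fintype.toLocallyFiniteOrder

section Glue
variable {r s t : ℕ}

/-- Inclusion of the two upper rows into three rows. -/
def topMid : Fin r ⊕ Fin s → Fin r ⊕ Fin s ⊕ Fin t := Sum.map id Sum.inl
/-- Inclusion of the two lower rows into three rows. -/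
def midBot : Fin s ⊕ Fin t → Fin r ⊕ Fin s ⊕ Fin t := Sum.inr
/-- Inclusion of the outer rows into three rows. -/
def topBot : Fin r ⊕ Fin t → Fin r ⊕ Fin s ⊕ Fin t := Sum.map id Sum.inr

/-- The partition of the three rows into the connected components of the diagram obtained by
drawing `π` on top of `ρ` with the middle rows identified. -/
def glue (π : Diagram r s) (ρ : Diagram s t) : Setoid (Fin r ⊕ Fin s ⊕ Fin t) :=
  Setoid.map π topMid ⊔ Setoid.map ρ midBot

/-- The partition induced by the gluing on the top and bottom rows. -/
@[reducible]
def starDiagram (π : Diagram r s) (ρ : Diagram s t) : Diagram r t :=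
  Setoid.comap topBot (glue π ρ)

/-- Components of the gluing lying entirely in the middle row. -/
def MiddleComponent (π : Diagram r s) (ρ : Diagram s t) : Type :=
  {q : Quotient (glue π ρ) //
    ∀ x, Quotient.mk (glue π ρ) x = q → ∃ j : Fin s, x = Sum.inr (Sum.inl j)}

/-- The number of connected components lying entirely in the middle row. -/
def loops (π : Diagram r s) (ρ : Diagram s t) : ℕ := Nat.card (MiddleComponent π ρ)

instance (π : Diagram r s) (ρ : Diagram s t) : Finite (MiddleComponent π ρ) :=
  inferInstanceAs (Finite {_q : Quotient (glue π ρ) // _})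

theorem glue_le_ker {α : Type*} (π : Diagram r s) (ρ : Diagram s t)
    (F : Fin r ⊕ Fin s ⊕ Fin t → α) :
    glue π ρ ≤ Setoid.ker F ↔
      π ≤ Setoid.ker (F ∘ topMid) ∧ ρ ≤ Setoid.ker (F ∘ midBot) := by
  rw [glue, sup_le_iff]
  have key : ∀ {β : Type} (σ : Setoid β) (i : β → Fin r ⊕ Fin s ⊕ Fin t),
      Setoid.map σ i ≤ Setoid.ker F ↔ σ ≤ Setoid.ker (F ∘ i) := by
    intro β σ i
    constructor
    · intro h x y hxy
      exact h (Setoid.le_comap_map hxy)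
    · intro h
      refine Setoid.eqvGen_le ?_
      rintro _ _ ⟨a, b, hab, rfl, rfl⟩
      exact h hab
  rw [key, key]

theorem elim_topMid {α : Type*} (f : Fin r → α) (h : Fin s → α) (g : Fin t → α) :
    Sum.elim f (Sum.elim h g) ∘ topMid = Sum.elim f h := by
  ext (x | x) <;> rfl
theorem elim_midBot {α : Type*} (f : Fin r → α) (h : Fin s → α) (g : Fin t → α) :
    Sum.elim f (Sum.elim h g) ∘ midBot = Sum.elim h g := by
  ext (x | x) <;> rfl
theorem elim_topBot {α : Type*} (f : Fin r → α) (h : Fin s → α) (g : Fin t → α) :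
    Sum.elim f (Sum.elim h g) ∘ topBot = Sum.elim f g := by
  ext (x | x) <;> rfl

/-- Number of labelings of the middle row compatible with both diagrams. -/
theorem card_labelings {α : Type} [Finite α] (π : Diagram r s) (ρ : Diagram s t)
    (f : Fin r → α) (g : Fin t → α) (hfg : starDiagram π ρ ≤ Setoid.ker (Sum.elim f g)) :
    Nat.card {h : Fin s → α // π ≤ Setoid.ker (Sum.elim f h) ∧ ρ ≤ Setoid.ker (Sum.elim h g)} =
      Nat.card α ^ loops π ρ := by
  classical
  rw [loops, ← Nat.card_fun]
  have hout : ∀ q : Quotient (glue π ρ),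
      ¬ (∀ x, Quotient.mk (glue π ρ) x = q → ∃ j : Fin s, x = Sum.inr (Sum.inl j)) →
      ∃ z : Fin r ⊕ Fin t, Quotient.mk (glue π ρ) (topBot z) = q := by
    intro q hq
    push Not at hq
    obtain ⟨x, hx, hne⟩ := hq
    rcases x with x | x | x
    · exact ⟨Sum.inl x, hx⟩
    · exact absurd rfl (hne x)
    · exact ⟨Sum.inr x, hx⟩
  choose z hz using hout
  let ext : (MiddleComponent π ρ → α) → Quotient (glue π ρ) → α := fun c q =>
    if hq : ∀ x, Quotient.mk (glue π ρ) x = q → ∃ j : Fin s, x = Sum.inr (Sum.inl j)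
      then c ⟨q, hq⟩ else Sum.elim f g (z q hq)
  have hext : ∀ c w, ext c (Quotient.mk _ (topBot w)) = Sum.elim f g w := by
    intro c w
    have hn : ¬ ∀ x, Quotient.mk (glue π ρ) x = Quotient.mk _ (topBot w) →
        ∃ j : Fin s, x = Sum.inr (Sum.inl j) := by
      intro h
      obtain ⟨j, hj⟩ := h _ rfl
      rcases w with w | w <;> simp [topBot] at hj
    simp only [ext, dif_neg hn]
    have hr : starDiagram π ρ (z _ hn) w :=
      (Quotient.exact (hz _ hn) : (glue π ρ) (topBot (z _ hn)) (topBot w))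
    exact hfg hr
  have hcomp : ∀ c, Sum.elim f (Sum.elim
      (fun j => ext c (Quotient.mk _ (Sum.inr (Sum.inl j)))) g) =
      fun x => ext c (Quotient.mk _ x) := by
    intro c
    funext x
    rcases x with x | x | x
    · exact (hext c (Sum.inl x)).symm
    · rfl
    · exact (hext c (Sum.inr x)).symm
  refine Nat.card_congr (Equiv.ofBijective (fun h => fun q : MiddleComponent π ρ =>
      Quotient.lift (Sum.elim f (Sum.elim h.1 g)) (fun a b hab => by
        have := (glue_le_ker π ρ (Sum.elim f (Sum.elim h.1 g))).2
          (by rw [elim_topMid, elim_midBot]; exact h.2)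
        exact this hab) q.1) ⟨?_, ?_⟩)
  · rintro ⟨h, hh⟩ ⟨h', hh'⟩ heq
    ext j
    have hl := (glue_le_ker π ρ (Sum.elim f (Sum.elim h g))).2
          (by rw [elim_topMid, elim_midBot]; exact hh)
    have hl' := (glue_le_ker π ρ (Sum.elim f (Sum.elim h' g))).2
          (by rw [elim_topMid, elim_midBot]; exact hh')
    by_cases hq : ∀ x, Quotient.mk (glue π ρ) x = Quotient.mk _ (Sum.inr (Sum.inl j)) →
        ∃ j : Fin s, x = Sum.inr (Sum.inl j)
    · exact congrFun heq ⟨_, hq⟩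
    · have hw := Quotient.exact (hz _ hq)
      have h1 := hl hw
      have h2 := hl' hw
      rw [Setoid.ker_def] at h1 h2
      have e1 := congrFun (elim_topBot f h g) (z _ hq)
      have e2 := congrFun (elim_topBot f h' g) (z _ hq)
      simp only [Function.comp] at e1 e2
      change _ = h j at h1
      change _ = h' j at h2
      change h j = h' j
      rw [← h1, ← h2, e1, e2]
  · intro c
    refine ⟨⟨fun j => ext c (Quotient.mk _ (Sum.inr (Sum.inl j))), ?_⟩, ?_⟩
    · have := (glue_le_ker π ρ (fun x => ext c (Quotient.mk _ x))).1
        (fun {x y} hxy => congrArg (ext c) (Quotient.sound hxy))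
      rw [← hcomp, elim_topMid, elim_midBot] at this
      exact this
    · funext q
      obtain ⟨q, hq⟩ := q
      induction q using Quotient.inductionOn with
      | h x =>
        change Sum.elim f _ x = _
        rw [hcomp]
        simp only [ext]
        rw [dif_pos hq]

theorem starDiagram_le_of_labeling {α : Type} (π : Diagram r s) (ρ : Diagram s t)
    (f : Fin r → α) (g : Fin t → α) (h : Fin s → α)
    (h1 : π ≤ Setoid.ker (Sum.elim f h)) (h2 : ρ ≤ Setoid.ker (Sum.elim h g)) :
    starDiagram π ρ ≤ Setoid.ker (Sum.elim f g) := by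
  have := (glue_le_ker π ρ (Sum.elim f (Sum.elim h g))).2
          (by rw [elim_topMid, elim_midBot]; exact ⟨h1, h2⟩)
  intro x y hxy
  have h3 := this hxy
  rw [Setoid.ker_def] at h3 ⊢
  have e1 := congrFun (elim_topBot f h g) x
  have e2 := congrFun (elim_topBot f h g) y
  simp only [Function.comp] at e1 e2
  rw [← e1, ← e2, h3]

end Glue

section Linear

/-- The vector space with basis the partitions of `{1, ..., r, 1', ..., s'}`. -/
abbrev DiagramSpace (r s : ℕ) : Type := Diagram r s →₀ ℂ

/-- Bilinear composition (first `a`, then `b`): the composite of the diagrams `π`, `ρ` is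
`ν ^ (loops π ρ)` times the induced diagram. -/
def compDiagrams (ν : ℂ) {r s t : ℕ} (a : DiagramSpace r s) (b : DiagramSpace s t) : DiagramSpace r t :=
  a.sum fun π c => b.sum fun ρ d => Finsupp.single (starDiagram π ρ) (c * d * ν ^ loops π ρ)

/-- The diagram with edges `i -- i'`. -/
@[reducible]
def idDiagram (k : ℕ) : Diagram k k := Setoid.ker (Sum.elim id id)

variable {r s t : ℕ}

theorem comp_eq (ν : ℂ) (a : DiagramSpace r s) (b : DiagramSpace s t) :
    compDiagrams ν a b = ∑ π, ∑ ρ, Finsupp.single (starDiagram π ρ) (a π * b ρ * ν ^ loops π ρ) := by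
  rw [compDiagrams, Finsupp.sum_fintype _ _ (by intro π; simp [Finsupp.sum])]
  refine Finset.sum_congr rfl fun π _ => ?_
  rw [Finsupp.sum_fintype _ _ (by intro ρ; simp)]

theorem comp_add_left (ν : ℂ) (a a' : DiagramSpace r s) (b : DiagramSpace s t) :
    compDiagrams ν (a + a') b = compDiagrams ν a b + compDiagrams ν a' b := by
  simp only [comp_eq, ← Finset.sum_add_distrib, Finsupp.add_apply, add_mul, Finsupp.single_add]

theorem comp_add_right (ν : ℂ) (a : DiagramSpace r s) (b b' : DiagramSpace s t) :
    compDiagrams ν a (b + b') = compDiagrams ν a b + compDiagrams ν a b' := by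
  simp only [comp_eq, ← Finset.sum_add_distrib, Finsupp.add_apply, add_mul, mul_add,
    Finsupp.single_add]

theorem comp_smul_left (ν c : ℂ) (a : DiagramSpace r s) (b : DiagramSpace s t) :
    compDiagrams ν (c • a) b = c • compDiagrams ν a b := by
  simp only [comp_eq, Finset.smul_sum, Finsupp.smul_apply, Finsupp.smul_single, smul_eq_mul,
    mul_assoc]

theorem comp_smul_right (ν c : ℂ) (a : DiagramSpace r s) (b : DiagramSpace s t) :
    compDiagrams ν a (c • b) = c • compDiagrams ν a b := by
  simp only [comp_eq, Finset.smul_sum, Finsupp.smul_apply, Finsupp.smul_single, smul_eq_mul]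
  refine Finset.sum_congr rfl fun π _ => Finset.sum_congr rfl fun ρ _ => ?_
  congr 1
  ring

open scoped Classical in
/-- The matrix by which an element of `DiagramSpace r s` acts on functions `Fin _ → Fin n`. -/
def realize (n : ℕ) (a : DiagramSpace r s) : Matrix (Fin r → Fin n) (Fin s → Fin n) ℂ :=
  fun f g => ∑ π : Diagram r s, if π ≤ Setoid.ker (Sum.elim f g) then a π else 0

theorem realize_comp (n : ℕ) (a : DiagramSpace r s) (b : DiagramSpace s t) :
    realize n (compDiagrams n a b) = realize n a * realize n b := by
  classical
  ext f g
  rw [Matrix.mul_apply]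
  simp only [realize, comp_eq, Finsupp.finsetSum_apply]
  have h1 : ∀ τ : Diagram r t, (if τ ≤ Setoid.ker (Sum.elim f g) then
      ∑ π, ∑ ρ, (Finsupp.single (starDiagram π ρ) (a π * b ρ * (n : ℂ) ^ loops π ρ)) τ else 0) =
      ∑ π, ∑ ρ, if τ ≤ Setoid.ker (Sum.elim f g) then
        (if starDiagram π ρ = τ then a π * b ρ * (n : ℂ) ^ loops π ρ else 0) else 0 := by
    intro τ
    split_ifs with h
    · simp only [Finsupp.single_apply]
    · simp
  simp only [h1]
  rw [Finset.sum_comm]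
  simp only [Finset.sum_mul_sum]
  conv_rhs => rw [Finset.sum_comm]
  refine Finset.sum_congr rfl fun π _ => ?_
  rw [Finset.sum_comm]
  conv_rhs => rw [Finset.sum_comm]
  refine Finset.sum_congr rfl fun ρ _ => ?_
  have h2 : ∑ τ : Diagram r t, (if τ ≤ Setoid.ker (Sum.elim f g) then
        (if starDiagram π ρ = τ then a π * b ρ * (n : ℂ) ^ loops π ρ else 0) else 0) =
      if starDiagram π ρ ≤ Setoid.ker (Sum.elim f g) then a π * b ρ * (n : ℂ) ^ loops π ρ else 0 := by
    rw [Finset.sum_eq_single (starDiagram π ρ)]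
    · simp
    · intro τ _ hτ
      simp [hτ.symm]
    · simp
  rw [h2]
  have h3 : ∀ h : Fin s → Fin n, ((if π ≤ Setoid.ker (Sum.elim f h) then a π else 0) *
      (if ρ ≤ Setoid.ker (Sum.elim h g) then b ρ else 0)) =
      if π ≤ Setoid.ker (Sum.elim f h) ∧ ρ ≤ Setoid.ker (Sum.elim h g) then a π * b ρ else 0 := by
    intro h
    by_cases h1 : π ≤ Setoid.ker (Sum.elim f h) <;>
      by_cases h2 : ρ ≤ Setoid.ker (Sum.elim h g) <;> simp [h1, h2]
  simp only [h3]
  rw [← Finset.sum_filter, Finset.sum_const, ← Fintype.card_subtype, ← Nat.card_eq_fintype_card]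
  split_ifs with hs
  · rw [card_labelings π ρ f g hs]
    simp [mul_comm]
  · have : IsEmpty {h : Fin s → Fin n //
        π ≤ Setoid.ker (Sum.elim f h) ∧ ρ ≤ Setoid.ker (Sum.elim h g)} :=
      ⟨fun h => hs (starDiagram_le_of_labeling π ρ f g h.1 h.2.1 h.2.2)⟩
    simp

theorem exists_labeling (n : ℕ) (hn : r + s ≤ n) (π : Diagram r s) :
    ∃ (f : Fin r → Fin n) (g : Fin s → Fin n), Setoid.ker (Sum.elim f g) = π := by
  classical
  have hc : Nat.card (Quotient π) ≤ n := by
    refine (Nat.card_le_card_of_surjective _ (Quotient.mk_surjective (s := π))).trans ?_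
    simpa using hn
  let e := (Finite.equivFin (Quotient π)).toEmbedding.trans (Fin.castLEEmb hc)
  refine ⟨fun i => e (Quotient.mk π (Sum.inl i)), fun i => e (Quotient.mk π (Sum.inr i)), ?_⟩
  have : Sum.elim (fun i => e (Quotient.mk π (Sum.inl i))) (fun i => e (Quotient.mk π (Sum.inr i)))
      = fun x => e (Quotient.mk π x) := by
    ext (x | x) <;> rfl
  rw [this]
  ext x y
  rw [Setoid.ker_def, e.injective.eq_iff]
  exact Quotient.eq

theorem realize_sub (n : ℕ) (a b : DiagramSpace r s) :
    realize n (a - b) = realize n a - realize n b := by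
  classical
  ext f g
  simp only [realize, Matrix.sub_apply, ← Finset.sum_sub_distrib]
  refine Finset.sum_congr rfl fun π _ => ?_
  split_ifs <;> simp

theorem realize_injective (n : ℕ) (hn : r + s ≤ n) {a b : DiagramSpace r s}
    (h : realize n a = realize n b) : a = b := by
  classical
  rw [← sub_eq_zero]
  have h0 : realize n (a - b) = 0 := by rw [realize_sub, h, sub_self]
  generalize a - b = d at h0
  ext π
  have : WellFoundedLT (Diagram r s) := inferInstance
  induction π using this.induction with
  | ind π ih =>
    obtain ⟨f, g, hfg⟩ := exists_labeling n hn π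
    have h1 := congrFun (congrFun h0 f) g
    simp only [realize, hfg] at h1
    rw [Finset.sum_eq_single π] at h1
    · simpa using h1
    · intro τ _ hτ
      split_ifs with hle
      · exact ih τ (lt_of_le_of_ne hle hτ)
      · rfl
    · simp

/-- Families of elements whose coefficients are polynomial in the parameter. -/
def IsPolyFamily (a : ℂ → DiagramSpace r s) : Prop :=
  ∀ π, ∃ p : Polynomial ℂ, ∀ ν, a ν π = p.eval ν

theorem IsPolyFamily.const (a : DiagramSpace r s) : IsPolyFamily fun _ => a :=
  fun π => ⟨Polynomial.C (a π), fun ν => by simp⟩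

theorem IsPolyFamily.comp {a : ℂ → DiagramSpace r s} {b : ℂ → DiagramSpace s t}
    (ha : IsPolyFamily a) (hb : IsPolyFamily b) :
    IsPolyFamily fun ν => compDiagrams ν (a ν) (b ν) := by
  classical
  choose p hp using ha
  choose q hq using hb
  intro τ
  refine ⟨∑ π, ∑ ρ, if starDiagram π ρ = τ then p π * q ρ * Polynomial.X ^ loops π ρ else 0, fun ν => ?_⟩
  simp only [comp_eq, Finsupp.finsetSum_apply, Finsupp.single_apply, Polynomial.eval_finsetSum]
  refine Finset.sum_congr rfl fun π _ => Finset.sum_congr rfl fun ρ _ => ?_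
  split_ifs
  · simp [hp, hq]
  · simp

/-- Polynomial families agree as soon as their realizations agree for all large integers. -/
theorem IsPolyFamily.ext {a b : ℂ → DiagramSpace r s} (ha : IsPolyFamily a) (hb : IsPolyFamily b)
    (h : ∀ n : ℕ, realize n (a n) = realize n (b n)) (ν : ℂ) : a ν = b ν := by
  ext π
  obtain ⟨p, hp⟩ := ha π
  obtain ⟨q, hq⟩ := hb π
  rw [hp, hq]
  congr 1
  refine Polynomial.eq_of_infinite_eval_eq p q ?_
  refine Set.Infinite.mono (s := (fun n : ℕ => (n : ℂ)) '' Set.Ici (r + s)) ?_ ?_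
  · rintro _ ⟨n, hn, rfl⟩
    change p.eval _ = q.eval _
    rw [← hp, ← hq, realize_injective n hn (h n)]
  · exact (Set.Ici_infinite _).image (Nat.cast_injective.injOn)

theorem comp_assoc (ν : ℂ) {u : ℕ} (a : DiagramSpace r s) (b : DiagramSpace s t)
    (c : DiagramSpace t u) : compDiagrams ν (compDiagrams ν a b) c = compDiagrams ν a (compDiagrams ν b c) := by
  refine IsPolyFamily.ext (a := fun ν => compDiagrams ν (compDiagrams ν a b) c)
    (b := fun ν => compDiagrams ν a (compDiagrams ν b c)) ?_ ?_ (fun n => ?_) ν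
  · exact ((IsPolyFamily.const a).comp (.const b)).comp (.const c)
  · exact (IsPolyFamily.const a).comp ((IsPolyFamily.const b).comp (.const c))
  · simp only [realize_comp, Matrix.mul_assoc]

theorem realize_single (n : ℕ) (π : Diagram r s) (f : Fin r → Fin n) (g : Fin s → Fin n)
    [Decidable (π ≤ Setoid.ker (Sum.elim f g))] :
    realize n (Finsupp.single π 1) f g = if π ≤ Setoid.ker (Sum.elim f g) then 1 else 0 := by
  classical
  rw [realize, Finset.sum_eq_single π]
  · simp
  · intro τ _ hτ
    simp [hτ.symm]
  · simp

theorem realize_id (n k : ℕ) : realize n (Finsupp.single (idDiagram k) 1) = 1 := by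
  classical
  ext f g
  rw [realize_single, Matrix.one_apply]
  congr 1
  simp only [eq_iff_iff]
  constructor
  · intro h
    ext i
    have : idDiagram k (Sum.inl i) (Sum.inr i) := rfl
    exact congrArg _ (h this)
  · rintro rfl
    rintro (x | x) (y | y) h <;> exact congrArg f h

theorem id_comp' (ν : ℂ) (a : DiagramSpace r s) :
    compDiagrams ν (Finsupp.single (idDiagram r) 1) a = a := by
  refine IsPolyFamily.ext (a := fun ν => compDiagrams ν (Finsupp.single (idDiagram r) 1) a)
    (b := fun _ => a) ((IsPolyFamily.const _).comp (.const a)) (.const a) (fun n => ?_) ν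
  rw [realize_comp, realize_id, Matrix.one_mul]

theorem comp_id' (ν : ℂ) (a : DiagramSpace r s) :
    compDiagrams ν a (Finsupp.single (idDiagram s) 1) = a := by
  refine IsPolyFamily.ext (a := fun ν => compDiagrams ν a (Finsupp.single (idDiagram s) 1))
    (b := fun _ => a) ((IsPolyFamily.const a).comp (.const _)) (.const a) (fun n => ?_) ν
  rw [realize_comp, realize_id, Matrix.mul_one]

open scoped Classical in
/-- The basis obtained by Moebius inversion over coarsenings, i.e. the elements determined by
`π = ∑ τ ≥ π, moebius τ`. -/
def moebius (π : Diagram r s) : DiagramSpace r s :=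
  Finsupp.equivFunOnFinite.symm fun τ => IncidenceAlgebra.mu ℂ π τ

theorem realize_moebius (n : ℕ) (π : Diagram r s) (f : Fin r → Fin n) (g : Fin s → Fin n)
    [Decidable (π = Setoid.ker (Sum.elim f g))] :
    realize n (moebius π) f g = if π = Setoid.ker (Sum.elim f g) then 1 else 0 := by
  classical
  have h := IncidenceAlgebra.sum_Icc_mu_right (𝕜 := ℂ) π (Setoid.ker (Sum.elim f g))
  rw [realize]
  convert h using 1
  · rw [← Finset.sum_filter]
    symm
    refine Finset.sum_subset_zero_on_sdiff ?_ ?_ ?_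
    · intro τ hτ
      simpa using (Finset.mem_Icc.1 hτ).2
    · intro τ hτ
      simp only [Finset.mem_sdiff, Finset.mem_filter, Finset.mem_univ, true_and, Finset.mem_Icc,
        not_and_or] at hτ
      simp only [moebius, Finsupp.equivFunOnFinite_symm_apply_apply]
      refine IncidenceAlgebra.apply_eq_zero_of_not_le ?_ _
      tauto
    · intro τ _
      simp only [moebius, Finsupp.equivFunOnFinite_symm_apply_apply]
  · congr

/-- No two vertices of the same row lie in the same part. -/
def IsBar (π : Diagram r s) : Prop :=
  (∀ i j : Fin r, π (Sum.inl i) (Sum.inl j) → i = j) ∧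
    ∀ i j : Fin s, π (Sum.inr i) (Sum.inr j) → i = j

theorem isBar_ker {m : ℕ} {a : Fin r → Fin m} {b : Fin s → Fin m} (ha : a.Injective)
    (hb : b.Injective) : IsBar (Setoid.ker (Sum.elim a b)) :=
  ⟨fun _ _ h => ha h, fun _ _ h => hb h⟩

/-- The idempotent whose image is `Δ_k`. -/
def injProj (k : ℕ) : DiagramSpace k k := moebius (idDiagram k)

theorem isBar_id (k : ℕ) : IsBar (idDiagram k) :=
  isBar_ker Function.injective_id Function.injective_id

theorem ker_eq_id {n k : ℕ} (f g : Fin k → Fin n) :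
    idDiagram k = Setoid.ker (Sum.elim f g) ↔ f = g ∧ f.Injective := by
  constructor
  · intro h
    have h1 : f = g := by
      ext i
      have h2 : Setoid.ker (Sum.elim f g) (Sum.inl i) (Sum.inr i) := h ▸ (rfl : _)
      exact congrArg _ h2
    refine ⟨h1, fun i j hij => ?_⟩
    have h2 : idDiagram k (Sum.inl i) (Sum.inl j) := h ▸ hij
    exact h2
  · rintro ⟨rfl, hf⟩
    ext x y
    rcases x with x | x <;> rcases y with y | y <;> exact (hf.eq_iff).symm

open scoped Classical in
theorem realize_injProj (n k : ℕ) :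
    realize n (injProj k) = Matrix.diagonal fun f => if f.Injective then 1 else 0 := by
  ext f g
  rw [injProj, realize_moebius, Matrix.diagonal_apply]
  by_cases h : f = g <;> simp [ker_eq_id, h]

theorem injProj_comp_moebius (ν : ℂ) {π : Diagram r s} (hπ : IsBar π) :
    compDiagrams ν (injProj r) (moebius π) = moebius π := by
  classical
  refine IsPolyFamily.ext (a := fun ν => compDiagrams ν (injProj r) (moebius π))
    (b := fun _ => moebius π) ((IsPolyFamily.const _).comp (.const _)) (.const _) (fun n => ?_) ν
  rw [realize_comp, realize_injProj]
  ext f g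
  rw [Matrix.diagonal_mul, realize_moebius]
  split_ifs with h1 h2 h2 <;> simp
  exact h1 fun i j hij => hπ.1 i j (by rw [h2]; exact hij)

theorem moebius_comp_injProj (ν : ℂ) {π : Diagram r s} (hπ : IsBar π) :
    compDiagrams ν (moebius π) (injProj s) = moebius π := by
  classical
  refine IsPolyFamily.ext (a := fun ν => compDiagrams ν (moebius π) (injProj s))
    (b := fun _ => moebius π) ((IsPolyFamily.const _).comp (.const _)) (.const _) (fun n => ?_) ν
  rw [realize_comp, realize_injProj]
  ext f g
  rw [Matrix.mul_diagonal, realize_moebius]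
  split_ifs with h1 h2 h2 <;> simp
  exact h2 fun i j hij => hπ.2 i j (by rw [h1]; exact hij)

end Linear

section LinearInstances

open CategoryTheory.Idempotents

variable {C : Type*} [Category C] [Preadditive C] [Linear ℂ C]

instance matHomModule (M N : Mat_ C) : Module ℂ (M ⟶ N) :=
  inferInstanceAs <| Module ℂ (∀ i j, M.X i ⟶ N.X j)

theorem mat_smul_apply {M N : Mat_ C} (c : ℂ) (f : M ⟶ N) (i j) : (c • f) i j = c • f i j := rfl

instance matLinear : Linear ℂ (Mat_ C) where
  smul_comp M N K c f g := by
    ext i k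
    simp [mat_smul_apply, Finset.smul_sum]
  comp_smul M N K f c g := by
    ext i k
    simp [mat_smul_apply, Finset.smul_sum]

instance karoubiSMul (P Q : Karoubi C) : SMul ℂ (P ⟶ Q) where
  smul c f := ⟨c • f.f, by rw [Linear.smul_comp, Linear.comp_smul, f.comm]⟩

theorem karoubi_smul_f {P Q : Karoubi C} (c : ℂ) (f : P ⟶ Q) : (c • f).f = c • f.f := rfl

instance karoubiHomModule (P Q : Karoubi C) : Module ℂ (P ⟶ Q) :=
  Function.Injective.module ℂ (Karoubi.inclusionHom P Q)
    (fun _ _ h => Karoubi.hom_ext _ _ h) (fun c f => karoubi_smul_f c f)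

instance karoubiLinear : Linear ℂ (Karoubi C) where
  smul_comp P Q R c f g := by
    ext
    simp [karoubi_smul_f]
  comp_smul P Q R f c g := by
    ext
    simp [karoubi_smul_f]

end LinearInstances

section IndLinear

universe u

theorem isIndObject_common {C : Type u} [Category.{0} C] {X : Cᵒᵖ ⥤ Type} (hX : IsIndObject X) (A : C)
    (m₁ m₂ : X.obj (Opposite.op A)) :
    ∃ (B : C) (g₁ g₂ : A ⟶ B) (z : X.obj (Opposite.op B)),
      X.map g₁.op z = m₁ ∧ X.map g₂.op z = m₂ := by
  let P := hX.presentation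
  have hc := isColimitOfPreserves ((evaluation Cᵒᵖ (Type)).obj (Opposite.op A)) P.isColimit
  obtain ⟨i₁, y₁, h₁⟩ := Types.jointly_surjective _ hc m₁
  obtain ⟨i₂, y₂, h₂⟩ := Types.jointly_surjective _ hc m₂
  let j := IsFiltered.max i₁ i₂
  let a₁ : A ⟶ P.F.obj i₁ := y₁
  let a₂ : A ⟶ P.F.obj i₂ := y₂
  have key : ∀ (i j : P.I) (u : i ⟶ j) (a : A ⟶ P.F.obj i),
      X.map (a ≫ P.F.map u).op ((P.ι.app j).app (Opposite.op (P.F.obj j)) (𝟙 (P.F.obj j))) =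
        (P.ι.app i).app (Opposite.op A) a := by
    intro i j u a
    have e1 := ConcreteCategory.congr_hom ((P.ι.app j).naturality (a ≫ P.F.map u).op)
      (𝟙 (P.F.obj j))
    have e2 := ConcreteCategory.congr_hom (NatTrans.congr_app (P.ι.naturality u)
      (Opposite.op A)) a
    refine e1.symm.trans (Eq.trans ?_ e2)
    change (P.ι.app j).app (Opposite.op A) ((a ≫ P.F.map u) ≫ 𝟙 _) =
      (P.ι.app j).app (Opposite.op A) (a ≫ P.F.map u)
    rw [Category.comp_id]
  refine ⟨P.F.obj j, a₁ ≫ P.F.map (IsFiltered.leftToMax i₁ i₂),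
    a₂ ≫ P.F.map (IsFiltered.rightToMax i₁ i₂),
    (P.ι.app j).app (Opposite.op (P.F.obj j)) (𝟙 (P.F.obj j)), ?_, ?_⟩
  · rw [← h₁]
    exact key i₁ j (IsFiltered.leftToMax i₁ i₂) a₁
  · rw [← h₂]
    exact key i₂ j (IsFiltered.rightToMax i₁ i₂) a₂

variable (C : Type u) [Category.{0} C] [Preadditive C] [Linear ℂ C]

/-- The `ℂ`-linear presheaves of vector spaces whose underlying presheaf of sets is an
ind-object. -/
def isLinearInd : ObjectProperty (Cᵒᵖ ⥤ ModuleCat.{0} ℂ) := fun M =>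
  ((∀ (A B : C) (f g : A ⟶ B), M.map (f + g).op = M.map f.op + M.map g.op) ∧
    ∀ (A B : C) (c : ℂ) (f : A ⟶ B), M.map (c • f).op = c • M.map f.op) ∧
  IsIndObject (M ⋙ forget (ModuleCat.{0} ℂ))

/-- Forgetting the vector space structure. -/
def linearIndForget : (isLinearInd C).FullSubcategory ⥤ Ind C :=
  ObjectProperty.lift _ ((isLinearInd C).ι ⋙ (Functor.whiskeringRight _ _ _).obj
    (forget (ModuleCat.{0} ℂ))) (fun M => M.2.2) ⋙ (Ind.equivalence C).inverse

instance : (linearIndForget C).Faithful := by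
  have : ((isLinearInd C).ι ⋙ (Functor.whiskeringRight _ _ _).obj
    (forget (ModuleCat.{0} ℂ))).Faithful := inferInstance
  exact inferInstanceAs (ObjectProperty.lift _ _ _ ⋙ (Ind.equivalence C).inverse).Faithful


instance : (linearIndForget C).Full := by
  have : ((isLinearInd C).ι ⋙ (Functor.whiskeringRight _ _ _).obj
    (forget (ModuleCat.{0} ℂ))).Full := by
    refine ⟨fun {M N} α => ?_⟩
    have hlin : ∀ (A : Cᵒᵖ), ∃ φ : M.obj.obj A →ₗ[ℂ] N.obj.obj A, ∀ m, φ m = α.app A m := by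
      intro A
      induction A with
      | op A =>
      have hn : ∀ {B : C} (g : A ⟶ B) (z : M.obj.obj (Opposite.op B)),
          α.app (Opposite.op A) (M.obj.map g.op z) =
            (N.obj.map g.op) (α.app (Opposite.op B) z : N.obj.obj (Opposite.op B)) := by
        intro B g z
        exact ConcreteCategory.congr_hom (α.naturality g.op) z
      refine ⟨{ toFun := fun m => α.app (Opposite.op A) m, map_add' := ?_, map_smul' := ?_ },
        fun m => rfl⟩
      · intro m₁ m₂
        obtain ⟨B, g₁, g₂, z, h₁, h₂⟩ := isIndObject_common M.2.2 A m₁ m₂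
        change M.obj.map g₁.op z = m₁ at h₁
        change M.obj.map g₂.op z = m₂ at h₂
        have e : m₁ + m₂ = M.obj.map (g₁ + g₂).op z := by
          rw [M.2.1.1, ← h₁, ← h₂]; rfl
        rw [e, hn, N.2.1.1, ← h₁, ← h₂, hn, hn]
        rfl
      · intro c m
        obtain ⟨B, g, -, z, h, -⟩ := isIndObject_common M.2.2 A m m
        change M.obj.map g.op z = m at h
        have e : c • m = M.obj.map (c • g).op z := by
          rw [M.2.1.2, ← h]; rfl
        rw [e, hn, N.2.1.2, ← h, hn]
        rfl
    choose φ hφ using hlin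
    refine ⟨ObjectProperty.homMk { app := fun A => ModuleCat.ofHom (φ A), naturality := ?_ }, ?_⟩
    · intro A B f
      ext m
      have := ConcreteCategory.congr_hom (α.naturality f) m
      change φ B (M.obj.map f m) = N.obj.map f (φ A m)
      rw [hφ, hφ]
      exact this
    · ext A m
      exact hφ A m
  exact inferInstanceAs (ObjectProperty.lift _ _ _ ⋙ (Ind.equivalence C).inverse).Full

instance : (linearIndForget C).EssSurj := by
  refine ⟨fun X => ?_⟩
  let P := X.presentation
  let D := P.F ⋙ linearYoneda ℂ C
  let M : Cᵒᵖ ⥤ ModuleCat.{0} ℂ := colimit D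
  let W := (Functor.whiskeringRight Cᵒᵖ _ _).obj (forget (ModuleCat.{0} ℂ))
  let i : M ⋙ forget (ModuleCat.{0} ℂ) ≅ (Ind.inclusion C).obj X :=
    (isColimitOfPreserves W (colimit.isColimit D)).coconePointUniqueUpToIso P.isColimit
  have hM : isLinearInd C M := by
    refine ⟨⟨fun A B f g => ?_, fun A B c f => ?_⟩, ⟨⟨X.presentation.extend i.inv⟩⟩⟩
    · refine (isColimitOfPreserves ((evaluation Cᵒᵖ (ModuleCat.{0} ℂ)).obj (Opposite.op B))
        (colimit.isColimit D)).hom_ext fun j => ?_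
      change (colimit.ι D j).app _ ≫ M.map _ = (colimit.ι D j).app _ ≫ (M.map _ + M.map _)
      rw [Preadditive.comp_add, ← NatTrans.naturality, ← NatTrans.naturality,
        ← NatTrans.naturality, ← Preadditive.add_comp]
      congr 1
      ext h
      exact Preadditive.add_comp _ _ _ f g h
    · refine (isColimitOfPreserves ((evaluation Cᵒᵖ (ModuleCat.{0} ℂ)).obj (Opposite.op B))
        (colimit.isColimit D)).hom_ext fun j => ?_
      change (colimit.ι D j).app _ ≫ M.map _ = (colimit.ι D j).app _ ≫ (c • M.map _)
      rw [Linear.comp_smul, ← NatTrans.naturality, ← NatTrans.naturality, ← Linear.smul_comp]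
      congr 1
      ext h
      exact Linear.smul_comp _ _ _ c f h
  exact ⟨⟨M, hM⟩, ⟨(Ind.equivalence C).inverse.mapIso (ObjectProperty.isoMk _ i) ≪≫
    ((Ind.equivalence C).unitIso.app X).symm⟩⟩

instance : (linearIndForget C).IsEquivalence where

/-- The additive structure on the ind-completion of a `ℂ`-linear category. -/
@[reducible]
def indPreadditive : Preadditive (Ind C) :=
  Preadditive.ofFullyFaithful (linearIndForget C).asEquivalence.fullyFaithfulInverse

theorem indInverse_add {X Y : Ind C} (f g : X ⟶ Y) :
    letI := indPreadditive C
    (linearIndForget C).asEquivalence.inverse.map (f + g) =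
      (linearIndForget C).asEquivalence.inverse.map f +
        (linearIndForget C).asEquivalence.inverse.map g :=
  (linearIndForget C).asEquivalence.fullyFaithfulInverse.map_preimage _

theorem indInverse_preimage_smul {X Y : Ind C} (c : ℂ) (f : X ⟶ Y) :
    letI := (linearIndForget C).asEquivalence.fullyFaithfulInverse.homEquiv (X := X)
      (Y := Y) |>.module ℂ
    (linearIndForget C).asEquivalence.inverse.map (c • f) =
      c • (linearIndForget C).asEquivalence.inverse.map f :=
  (linearIndForget C).asEquivalence.fullyFaithfulInverse.map_preimage _

/-- The `ℂ`-linear structure on the ind-completion of a `ℂ`-linear category. -/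
@[reducible]
def indLinear : letI := indPreadditive C; Linear ℂ (Ind C) :=
  letI := indPreadditive C
  { homModule := fun _ _ =>
      (linearIndForget C).asEquivalence.fullyFaithfulInverse.homEquiv.module ℂ
    smul_comp := fun X Y Z c f g =>
      (linearIndForget C).asEquivalence.fullyFaithfulInverse.map_injective (by
        rw [Functor.map_comp, indInverse_preimage_smul, indInverse_preimage_smul,
          Functor.map_comp, Linear.smul_comp])
    comp_smul := fun X Y Z f c g =>
      (linearIndForget C).asEquivalence.fullyFaithfulInverse.map_injective (by
        rw [Functor.map_comp, indInverse_preimage_smul, indInverse_preimage_smul,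
          Functor.map_comp, Linear.comp_smul]) }

/-- The linear Yoneda embedding. -/
def linearIndYoneda : C ⥤ (isLinearInd C).FullSubcategory :=
  ObjectProperty.lift _ (linearYoneda ℂ C) fun X =>
    ⟨⟨fun A B f g => by ext h; exact Preadditive.add_comp _ _ _ f g h,
      fun A B c f => by ext h; exact Linear.smul_comp _ _ _ c f h⟩, isIndObject_yoneda X⟩

theorem linearIndForget_add {M N : (isLinearInd C).FullSubcategory} (a b : M ⟶ N) :
    letI := indPreadditive C
    (linearIndForget C).map (a + b) = (linearIndForget C).map a + (linearIndForget C).map b := by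
  let := indPreadditive C
  apply (linearIndForget C).asEquivalence.inverse.map_injective
  rw [indInverse_add]
  have key := fun (f : M ⟶ N) => (linearIndForget C).asEquivalence.inv_fun_map M N f
  refine (key (a + b)).trans ?_
  rw [Preadditive.add_comp, Preadditive.comp_add]
  exact congrArg₂ (· + ·) (key a).symm (key b).symm

theorem linearIndForget_smul {M N : (isLinearInd C).FullSubcategory} (c : ℂ) (a : M ⟶ N) :
    letI := indPreadditive C
    letI := indLinear C
    (linearIndForget C).map (c • a) = c • (linearIndForget C).map a := by
  let := indPreadditive C
  let := indLinear C
  apply (linearIndForget C).asEquivalence.inverse.map_injective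
  refine Eq.trans ?_ (indInverse_preimage_smul C c ((linearIndForget C).map a)).symm
  have key := fun (f : M ⟶ N) => (linearIndForget C).asEquivalence.inv_fun_map M N f
  refine (key (c • a)).trans ?_
  rw [Linear.smul_comp, Linear.comp_smul]
  exact congrArg (c • ·) (key a).symm

theorem indYoneda_add {X Y : C} (f g : X ⟶ Y) :
    letI := indPreadditive C
    Ind.yoneda.map (f + g) = Ind.yoneda.map f + Ind.yoneda.map g := by
  let := indPreadditive C
  have h : (linearIndYoneda C).map (f + g) =
      (linearIndYoneda C).map f + (linearIndYoneda C).map g := by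
    ext A h
    exact Preadditive.comp_add _ _ _ h f g
  exact (congrArg (linearIndForget C).map h).trans (linearIndForget_add C _ _)

theorem indYoneda_smul {X Y : C} (c : ℂ) (f : X ⟶ Y) :
    letI := indPreadditive C
    letI := indLinear C
    Ind.yoneda.map (c • f) = c • Ind.yoneda.map f := by
  let := indPreadditive C
  let := indLinear C
  have h : (linearIndYoneda C).map (c • f) = c • (linearIndYoneda C).map f := by
    ext A h
    exact Linear.comp_smul _ _ _ h c f
  exact (congrArg (linearIndForget C).map h).trans (linearIndForget_smul C _ _)

end IndLinear

section Category

open CategoryTheory.Idempotents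

/-- The object `h^{⊗ exponent}`, the tensor power of the generating object `h`. -/
structure HPower (ν : ℂ) : Type where
  /-- the exponent -/
  exponent : ℕ

instance (ν : ℂ) : Category.{0} (HPower ν) where
  Hom X Y := DiagramSpace X.exponent Y.exponent
  id X := Finsupp.single (idDiagram X.exponent) 1
  comp a b := compDiagrams ν a b
  id_comp := id_comp' ν
  comp_id := comp_id' ν
  assoc a b c := comp_assoc ν a b c

instance (ν : ℂ) : Preadditive (HPower ν) where
  homGroup X Y := inferInstanceAs <| AddCommGroup (DiagramSpace X.exponent Y.exponent)
  add_comp _ _ _ a a' b := comp_add_left ν a a' b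
  comp_add _ _ _ a b b' := comp_add_right ν a b b'

instance (ν : ℂ) : Linear ℂ (HPower ν) where
  homModule X Y := inferInstanceAs <| Module ℂ (DiagramSpace X.exponent Y.exponent)
  smul_comp _ _ _ c a b := comp_smul_left ν c a b
  comp_smul _ _ _ a c b := comp_smul_right ν c a b

/-- Deligne's category: the Karoubi envelope of the additive envelope of the `ℂ`-linear category of
tensor powers of `h`. -/
abbrev RepS (ν : ℂ) : Type 1 := Karoubi (Mat_ (HPower ν))

instance (ν : ℂ) : Preadditive (Ind (RepS ν)) := indPreadditive _
instance (ν : ℂ) : Linear ℂ (Ind (RepS ν)) := indLinear _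
instance (ν : ℂ) : (Ind.yoneda (C := RepS ν)).Additive := ⟨indYoneda_add _ _ _⟩
instance (ν : ℂ) : (Ind.yoneda (C := RepS ν)).Linear ℂ := ⟨fun f c => indYoneda_smul _ c f⟩

variable {ν : ℂ}

/-- The morphism `h^{⊗ r} ⟶ h^{⊗ s}` given by a combination of diagrams. -/
def hHom (ν : ℂ) {r s : ℕ} (a : DiagramSpace r s) :
    (Mat_.embedding (HPower ν)).obj ⟨r⟩ ⟶ (Mat_.embedding (HPower ν)).obj ⟨s⟩ :=
  (Mat_.embedding (HPower ν)).map a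

theorem hHom_comp {r s t : ℕ} (a : DiagramSpace r s) (b : DiagramSpace s t) :
    hHom ν a ≫ hHom ν b = hHom ν (compDiagrams ν a b) :=
  ((Mat_.embedding (HPower ν)).map_comp (X := ⟨r⟩) (Y := ⟨s⟩) (Z := ⟨t⟩) a b).symm

/-- The object `Δ_k`, the image of an idempotent of `h^{⊗ k}`. -/
def Delta (ν : ℂ) (k : ℕ) : RepS ν where
  X := (Mat_.embedding (HPower ν)).obj ⟨k⟩
  p := hHom ν (injProj k)
  idem := by rw [hHom_comp]; exact congrArg _ (injProj_comp_moebius ν (isBar_id k))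

/-- The morphism `Δ_r ⟶ Δ_s` given by a diagram in which no two vertices of a row are connected;
these form a basis of the space of morphisms. -/
def deltaHom (ν : ℂ) {r s : ℕ} (π : Diagram r s) (hπ : IsBar π) : Delta ν r ⟶ Delta ν s where
  f := hHom ν (moebius π)
  comm := by
    change hHom ν (injProj r) ≫ hHom ν (moebius π) ≫ hHom ν (injProj s) = _
    rw [hHom_comp, hHom_comp, moebius_comp_injProj ν hπ, injProj_comp_moebius ν hπ]

/-- Top vertex `l` is solitary; the other top vertices are joined, in order, to the bottom row. -/
@[reducible]
def resDiagram {k : ℕ} (l : Fin (k + 1)) : Diagram (k + 1) k :=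
  Setoid.ker (Sum.elim id l.succAbove)

/-- Bottom vertex `l` is solitary; the other bottom vertices are joined, in order, to the top row. -/
@[reducible]
def resStarDiagram {k : ℕ} (l : Fin (k + 1)) : Diagram k (k + 1) :=
  Setoid.ker (Sum.elim l.succAbove id)

/-- Top vertex `i` is joined to bottom vertex `σ i`. -/
@[reducible]
def permDiagram {k : ℕ} (σ : Equiv.Perm (Fin k)) : Diagram k k :=
  Setoid.ker (Sum.elim σ id)

/-- The morphism `res_l : Δ_{k+1} ⟶ Δ_k`. -/
def res (ν : ℂ) {k : ℕ} (l : Fin (k + 1)) : Delta ν (k + 1) ⟶ Delta ν k :=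
  deltaHom ν (resDiagram l) (isBar_ker Function.injective_id Fin.succAbove_right_injective)

/-- The morphism `res_l^* : Δ_k ⟶ Δ_{k+1}`. -/
def resStar (ν : ℂ) {k : ℕ} (l : Fin (k + 1)) : Delta ν k ⟶ Delta ν (k + 1) :=
  deltaHom ν (resStarDiagram l) (isBar_ker Fin.succAbove_right_injective Function.injective_id)

/-- The action of `S_k` on `Δ_k`. -/
def permDelta (ν : ℂ) {k : ℕ} (σ : Equiv.Perm (Fin k)) : Delta ν k ⟶ Delta ν k :=
  deltaHom ν (permDiagram σ) (isBar_ker σ.injective Function.injective_id)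

theorem permDiagram_eq_ker {n k : ℕ} (σ : Equiv.Perm (Fin k)) (f g : Fin k → Fin n) :
    permDiagram σ = Setoid.ker (Sum.elim f g) ↔ f = g ∘ σ ∧ g.Injective := by
  constructor
  · intro h
    have h1 : f = g ∘ σ := by
      ext i
      have h2 : Setoid.ker (Sum.elim f g) (Sum.inl i) (Sum.inr (σ i)) := h ▸ (rfl : _)
      exact congrArg _ h2
    refine ⟨h1, fun i j hij => ?_⟩
    have h2 : permDiagram σ (Sum.inr i) (Sum.inr j) := h ▸ hij
    exact h2
  · rintro ⟨rfl, hg⟩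
    ext x y
    rcases x with x | x <;> rcases y with y | y <;> exact (hg.eq_iff).symm

theorem moebius_perm_comp {k : ℕ} (σ τ : Equiv.Perm (Fin k)) :
    compDiagrams ν (moebius (permDiagram σ)) (moebius (permDiagram τ)) =
      moebius (permDiagram (τ * σ)) := by
  classical
  refine IsPolyFamily.ext
    (a := fun ν => compDiagrams ν (moebius (permDiagram σ)) (moebius (permDiagram τ)))
    (b := fun _ => moebius (permDiagram (τ * σ)))
    ((IsPolyFamily.const _).comp (.const _)) (.const _) (fun n => ?_) ν
  rw [realize_comp]
  ext f g
  rw [Matrix.mul_apply]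
  simp only [realize_moebius, permDiagram_eq_ker]
  rw [Finset.sum_eq_single (g ∘ τ)]
  · by_cases hg : g.Injective
    · simp [hg, hg.comp τ.injective, Function.comp_assoc]
    · simp [hg]
  · intro h _ hh
    simp [hh]
  · simp

theorem permDelta_comp {k : ℕ} (σ τ : Equiv.Perm (Fin k)) :
    permDelta ν σ ≫ permDelta ν τ = permDelta ν (τ * σ) := by
  apply Karoubi.hom_ext
  change hHom ν _ ≫ hHom ν _ = hHom ν _
  rw [hHom_comp]
  exact congrArg _ (moebius_perm_comp σ τ)

theorem permDelta_one (k : ℕ) : permDelta ν (1 : Equiv.Perm (Fin k)) = 𝟙 (Delta ν k) := rfl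

end Category

section Tensor

open TensorProduct PiTensorProduct

variable {U : Type*} [AddCommGroup U] [Module ℂ U]

/-- `u^{(l)}`: insert the factor `u` in position `l`. -/
def insertFactor {k : ℕ} (u : U) (l : Fin (k + 1)) : (⨂[ℂ]^k U) →ₗ[ℂ] (⨂[ℂ]^(k + 1) U) :=
  PiTensorProduct.lift ((PiTensorProduct.tprod ℂ (s := fun _ : Fin (k + 1) => U)).curryMid l u)

theorem insertFactor_tprod {k : ℕ} (u : U) (l : Fin (k + 1)) (v : Fin k → U) :
    insertFactor u l (PiTensorProduct.tprod ℂ v) =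
      PiTensorProduct.tprod ℂ (l.insertNth (α := fun _ => U) u v) := by
  simp [insertFactor]

/-- `f^{(l)}`: apply the functional `f` to the factor in position `l`. -/
def contractFactor {k : ℕ} (f : Module.Dual ℂ U) (l : Fin (k + 1)) :
    (⨂[ℂ]^(k + 1) U) →ₗ[ℂ] (⨂[ℂ]^k U) :=
  PiTensorProduct.lift (LinearMap.uncurryMid (M := fun _ => U) l
    (f.smulRight (PiTensorProduct.tprod ℂ (s := fun _ : Fin k => U))))

theorem contractFactor_tprod {k : ℕ} (f : Module.Dual ℂ U) (l : Fin (k + 1))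
    (v : Fin (k + 1) → U) :
    contractFactor f l (PiTensorProduct.tprod ℂ v) =
      f (v l) • PiTensorProduct.tprod ℂ fun i => v (l.succAbove i) := by
  simp [contractFactor]; rfl

/-- `A^{(i)}`: apply `A` to the factor in position `i`. -/
def factorAction {k : ℕ} (A : Module.End ℂ U) (i : Fin k) : (⨂[ℂ]^k U) →ₗ[ℂ] (⨂[ℂ]^k U) :=
  PiTensorProduct.map (Function.update (fun _ => LinearMap.id) i A)

/-- The action of `S_k` on `U^{⊗ k}`: the factor in position `i` moves to position `σ i`. -/
def permFactors {k : ℕ} (σ : Equiv.Perm (Fin k)) : (⨂[ℂ]^k U) →ₗ[ℂ] (⨂[ℂ]^k U) :=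
  (PiTensorProduct.reindex ℂ (fun _ => U) σ).toLinearMap

theorem permFactors_tprod {k : ℕ} (σ : Equiv.Perm (Fin k)) (v : Fin k → U) :
    permFactors σ (PiTensorProduct.tprod ℂ v) = PiTensorProduct.tprod ℂ fun i => v (σ.symm i) := by
  simp [permFactors]

theorem permFactors_comp {k : ℕ} (σ τ : Equiv.Perm (Fin k)) :
    (permFactors (U := U) τ) ∘ₗ permFactors σ = permFactors (τ * σ) := by
  ext v
  simp [permFactors_tprod]
  rfl

theorem permFactors_one (k : ℕ) :
    permFactors (U := U) (1 : Equiv.Perm (Fin k)) = LinearMap.id := by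
  ext v
  simp [permFactors_tprod]
  rfl

end Tensor

section TensorObj

variable {D : Type*} [Category D] [Preadditive D] [Linear ℂ D] [HasFiniteBiproducts D]

/-- The object `W ⊗ X` for a finite-dimensional vector space `W`: the sum of `dim W` copies of `X`,
indexed by a fixed basis of `W`. -/
abbrev vtensor (W : Type*) [AddCommGroup W] [Module ℂ W] [Module.Finite ℂ W] (X : D) : D :=
  ⨁ fun _ : Fin (Module.finrank ℂ W) => X

variable {W W' W'' : Type*} [AddCommGroup W] [Module ℂ W] [Module.Finite ℂ W]
  [AddCommGroup W'] [Module ℂ W'] [Module.Finite ℂ W']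
  [AddCommGroup W''] [Module ℂ W''] [Module.Finite ℂ W'']

/-- The morphism `A ⊗ φ : W ⊗ X ⟶ W' ⊗ Y`. -/
def vtensorMap (A : W →ₗ[ℂ] W') {X Y : D} (φ : X ⟶ Y) : vtensor W X ⟶ vtensor W' Y :=
  biproduct.matrix fun j i =>
    LinearMap.toMatrix (Module.finBasis ℂ W) (Module.finBasis ℂ W') A i j • φ

theorem vtensorMap_comp (A : W →ₗ[ℂ] W') (B : W' →ₗ[ℂ] W'') {X Y Z : D} (φ : X ⟶ Y) (ψ : Y ⟶ Z) :
    vtensorMap A φ ≫ vtensorMap B ψ = vtensorMap (B ∘ₗ A) (φ ≫ ψ) := by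
  apply biproduct.hom_ext'
  intro j
  apply biproduct.hom_ext
  intro i
  simp only [vtensorMap, Category.assoc, biproduct.matrix_π, biproduct.ι_desc,
    biproduct.ι_matrix_assoc, biproduct.lift_desc]
  rw [LinearMap.toMatrix_comp _ (Module.finBasis ℂ W'), Matrix.mul_apply, Finset.sum_smul]
  refine Finset.sum_congr rfl fun m _ => ?_
  rw [Linear.smul_comp, Linear.comp_smul, smul_smul, mul_comm]

theorem vtensorMap_id (X : D) : vtensorMap (LinearMap.id : W →ₗ[ℂ] W) (𝟙 X) = 𝟙 _ := by
  apply biproduct.hom_ext'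
  intro j
  apply biproduct.hom_ext
  intro i
  simp only [vtensorMap, Category.assoc, biproduct.matrix_π, biproduct.ι_desc,
    LinearMap.toMatrix_id, Category.comp_id]
  rw [biproduct.ι_π, Matrix.one_apply]
  by_cases h : i = j
  · subst h; simp
  · simp [h, Ne.symm h]

end TensorObj

/-- Invariants of a finite group in a `ℂ`-linear idempotent complete category. -/
theorem hasInvariants {D : Type*} [Category D] [Preadditive D] [Linear ℂ D]
    [IsIdempotentComplete D] {G : Type} [Group G] [Finite G] {X : D} (ρ : G → (X ⟶ X))
    (h1 : ρ 1 = 𝟙 X) (hm : ∀ g h, ρ g ≫ ρ h = ρ (h * g)) : HasWideEqualizer ρ := by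
  have := Fintype.ofFinite G
  let e : X ⟶ X := (Fintype.card G : ℂ)⁻¹ • ∑ g, ρ g
  have hcard : (Fintype.card G : ℂ) ≠ 0 := by simp
  have he : ∀ {Z : D} (z : Z ⟶ X), (∀ g, z ≫ ρ g = z) → z ≫ e = z := by
    intro Z z hz
    simp only [e, Linear.comp_smul, Preadditive.comp_sum, hz, Finset.sum_const, Finset.card_univ]
    rw [← Nat.cast_smul_eq_nsmul ℂ, smul_smul, inv_mul_cancel₀ hcard, one_smul]
  have heg : ∀ g, e ≫ ρ g = e := by
    intro g
    simp only [e, Linear.smul_comp, Preadditive.sum_comp, hm]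
    congr 1
    exact Fintype.sum_equiv (Equiv.mulLeft g) _ _ fun h => rfl
  obtain ⟨Y, i, p, hip, hpi⟩ := IsIdempotentComplete.idempotents_split X e (he e heg)
  have hi : ∀ g, i ≫ ρ g = i := by
    intro g
    have : p ≫ i ≫ ρ g = p ≫ i := by rw [← Category.assoc, hpi, heg]
    have h2 := congrArg (i ≫ ·) this
    simpa only [← Category.assoc, hip, Category.id_comp] using h2
  have hl : ∀ s : Trident ρ, (s.ι ≫ p : s.pt ⟶ Y) ≫ i = s.ι := by
    intro s
    have h3 : ∀ z : s.pt ⟶ X, (∀ g h, z ≫ ρ g = z ≫ ρ h) → (z ≫ p) ≫ i = z := by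
      intro z hz
      rw [Category.assoc, hpi]
      refine he _ fun g => ?_
      rw [hz g 1, h1, Category.comp_id]
    exact h3 s.ι s.condition
  have hu : ∀ {Z : D} (m : Z ⟶ Y) (z : Z ⟶ X), m ≫ i = z → m = z ≫ p := by
    intro Z m z h
    rw [← h, Category.assoc, hip, Category.comp_id]
  exact ⟨⟨⟨Trident.ofι i fun g h => by rw [hi, hi], Trident.IsLimit.mk _ (fun s => s.ι ≫ p)
    hl (fun s m hm' => hu m s.ι (hm' WalkingParallelFamily.zero))⟩⟩⟩

section TensorPower

variable (ν : ℂ) (U : Type*) [AddCommGroup U] [Module ℂ U] [Module.Finite ℂ U]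

open TensorProduct

/-- The object `U^{⊗ k} ⊗ Δ_k`. -/
abbrev UDelta (k : ℕ) : RepS ν := vtensor (⨂[ℂ]^k U) (Delta ν k)

/-- The diagonal action of `S_k` on `U^{⊗ k} ⊗ Δ_k`. -/
def symAction (k : ℕ) (σ : Equiv.Perm (Fin k)) : UDelta ν U k ⟶ UDelta ν U k :=
  vtensorMap (permFactors σ) (permDelta ν σ)

instance (k : ℕ) : HasWideEqualizer (symAction ν U k) :=
  hasInvariants _
    (by
      rw [symAction, permDelta_one, permFactors_one]
      exact vtensorMap_id _)
    (fun σ τ => by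
      rw [symAction, symAction, symAction, vtensorMap_comp, permFactors_comp, permDelta_comp])

/-- The object of invariants `(U^{⊗ k} ⊗ Δ_k)^{S_k}`: the universal object over `U^{⊗ k} ⊗ Δ_k` on
which all elements of `S_k`, including the identity, act in the same way. -/
abbrev invPart (k : ℕ) : RepS ν := wideEqualizer (symAction ν U k)

/-- The monomorphism `(U^{⊗ k} ⊗ Δ_k)^{S_k} ⟶ U^{⊗ k} ⊗ Δ_k`. -/
abbrev invIncl (k : ℕ) : invPart ν U k ⟶ UDelta ν U k := wideEqualizer.ι (symAction ν U k)

/-- The complex tensor power `⨁_k (U^{⊗ k} ⊗ Δ_k)^{S_k}` of `ℂ e ⊕ U`. -/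
abbrev cpow : Ind (RepS ν) := ∐ fun k : ℕ => Ind.yoneda.obj (invPart ν U k)

/-- The inclusion of the `k`-th summand. -/
abbrev cpowIncl (k : ℕ) : Ind.yoneda.obj (invPart ν U k) ⟶ cpow ν U :=
  Sigma.ι (fun k : ℕ => Ind.yoneda.obj (invPart ν U k)) k

variable {U}

/-- `1/(k+1) ∑_l u^{(l)} ⊗ res_l^*` on `U^{⊗ k} ⊗ Δ_k`. -/
def opF (u : U) (k : ℕ) : UDelta ν U k ⟶ UDelta ν U (k + 1) :=
  ((k : ℂ) + 1)⁻¹ • ∑ l : Fin (k + 1), vtensorMap (insertFactor u l) (resStar ν l)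

/-- `∑_l f^{(l)} ⊗ res_l` on `U^{⊗ (k+1)} ⊗ Δ_{k+1}`. -/
def opE (f : Module.Dual ℂ U) (k : ℕ) : UDelta ν U (k + 1) ⟶ UDelta ν U k :=
  ∑ l : Fin (k + 1), vtensorMap (contractFactor f l) (res ν l)

/-- `∑_i A^{(i)} ⊗ id` on `U^{⊗ k} ⊗ Δ_k`. -/
def opA (A : Module.End ℂ U) (k : ℕ) : UDelta ν U k ⟶ UDelta ν U k :=
  ∑ i : Fin k, vtensorMap (factorAction A i) (𝟙 (Delta ν k))

end TensorPower

section gl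
variable {V : Type*} [AddCommGroup V] [Module ℂ V] {e : V} (he : e ≠ 0) {U : Submodule ℂ V}
  (hU : IsCompl (Submodule.span ℂ {e}) U)

/-- The coefficient of `e` in the decomposition `V = ℂ e ⊕ U`. -/
def coordE : V →ₗ[ℂ] ℂ :=
  (LinearEquiv.toSpanNonzeroSingleton ℂ V e he).symm.toLinearMap ∘ₗ
    (Submodule.span ℂ {e}).projectionOnto U hU

/-- The element of `gl(V)` given by `u ∈ U`: it sends `e` to `u` and kills `U`. -/
def lowering (u : U) : Module.End ℂ V := (coordE he hU).smulRight (u : V)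

/-- The element of `gl(V)` given by `f ∈ U^*`: it sends `w ∈ U` to `f(w) e` and kills `e`. -/
def raising (f : Module.Dual ℂ U) : Module.End ℂ V :=
  (f ∘ₗ U.projectionOnto (Submodule.span ℂ {e}) hU.symm).smulRight e

/-- The element of `gl(V)` given by `A ∈ gl(U)`: it is `A` on `U` and kills `e`. -/
def extendEnd (A : Module.End ℂ U) : Module.End ℂ V :=
  U.subtype ∘ₗ A ∘ₗ U.projectionOnto (Submodule.span ℂ {e}) hU.symm

end gl
end DeligneSn

end

attribute [local instance] LieRing.ofAssociativeRing

open CategoryTheory Limits DeligneSn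

/-! Under `realize n` the element x_π becomes the 0-1 matrix supported on the pairs (f, g) of
functions into an n-element set whose joint kernel is π. All coefficients are polynomial in ν, so an
identity between composites holds for every ν once it holds in these realizations for all n. Thus
Δ_k may be treated as if it were the space of functions on injections from k points into n points,
and every relation needed for `res` and `resStar` becomes a count of injections. Two insertions, or
two deletions, commute up to reindexing. Permutations slide past both. Inserting and deleting at the
same position gives ν - k, because an injection of k points has n - k extensions. Finally,
`moebius_resStar_succ_comp_res_zero` says that inserting at j + 1 and then deleting position 0 is
the same as deleting position 0 and then inserting at j, minus a cyclic permutation. The correction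
removes the case in which the deleted value is inserted again.

The tensor factors satisfy parallel relations without a correction, and there u^{(j)} f^{(0)} equals
T_{f,u}^{(j)} preceded by the same cyclic permutation. The correction on `UDelta` is therefore
T_{f,u}^{(j)} preceded by an element of the symmetric group, which is invisible on invariants. All
summands of E_f agree on invariants, so E_f is k + 1 times its summand at position 0, and this
factor cancels the 1/(k+1) of F_u in both E_f F_u and F_u E_f. What survives of the commutator is (ν
- k) f(u) minus the sum of the T_{f,u}^{(i)}; this is `invF_comp_invE_zero` and
`invF_comp_invE_succ`.

For the Lie algebra, gl(V) is the sum of ℂp, U, U^* and gl(U), where p = id_V - id_U is the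
projection onto the distinguished line. Since id_V must act by ν and id_U acts by k in degree k, p
must act by ν - k. The commutator formula then reads [f, u] = f(u) p - T_{f,u}, the relation in
gl(V). `exists_lieHom` shows that this relation and the elementary ones suffice. Uniqueness holds
because id_V, U, U^* and gl(U) span gl(V). -/

namespace DeligneSn

/-! ### Composites of diagrams of injections, computed by counting functions. -/

section DiagramIdentities

variable {r s t k : ℕ}

/-- Combined with `realize_moebius`, this describes the matrix entries of the diagram attached to a
map `a`: composition of such diagrams turns into substitution of functions. -/
theorem elim_id_eq_ker {n : ℕ} {a : Fin r → Fin s} (f : Fin r → Fin n) (g : Fin s → Fin n) :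
    Setoid.ker (Sum.elim a id) = Setoid.ker (Sum.elim f g) ↔ f = g ∘ a ∧ g.Injective := by
  constructor
  · intro h
    have h1 : f = g ∘ a := by
      ext i
      have h2 : Setoid.ker (Sum.elim f g) (Sum.inl i) (Sum.inr (a i)) := h ▸ (rfl : _)
      exact congrArg _ h2
    refine ⟨h1, fun i j hij => ?_⟩
    have h2 : Setoid.ker (Sum.elim a id) (Sum.inr i) (Sum.inr j) := h ▸ hij
    exact h2
  · rintro ⟨rfl, hg⟩
    ext x y
    rcases x with x | x <;> rcases y with y | y <;> exact (hg.eq_iff).symm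

theorem id_elim_eq_ker {n : ℕ} {b : Fin s → Fin r} (f : Fin r → Fin n) (g : Fin s → Fin n) :
    Setoid.ker (Sum.elim id b) = Setoid.ker (Sum.elim f g) ↔ g = f ∘ b ∧ f.Injective := by
  constructor
  · intro h
    have h1 : g = f ∘ b := by
      ext i
      have h2 : Setoid.ker (Sum.elim f g) (Sum.inl (b i)) (Sum.inr i) := h ▸ (rfl : _)
      exact congrArg _ (Eq.symm h2)
    refine ⟨h1, fun i j hij => ?_⟩
    have h2 : Setoid.ker (Sum.elim id b) (Sum.inl i) (Sum.inl j) := h ▸ hij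
    exact h2
  · rintro ⟨rfl, hf⟩
    ext x y
    rcases x with x | x <;> rcases y with y | y <;> exact (hf.eq_iff).symm

/-- A permutation can thus be composed both with `resStar` (diagrams of the form `Sum.elim a id`)
and with `res` (diagrams of the form `Sum.elim id b`). -/
theorem permDiagram_eq_elim_symm (σ : Equiv.Perm (Fin k)) :
    permDiagram σ = Setoid.ker (Sum.elim id σ.symm) := by
  ext x y
  rcases x with x | x <;> rcases y with y | y <;>
    simp [Setoid.ker_def, Equiv.eq_symm_apply, Equiv.symm_apply_eq]

/-- In the matrix product the intermediate function is forced to be `g ∘ b`, so a single term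
survives and ν does not appear. Injectivity of `b` makes this intermediate function injective
whenever `g` is. -/
theorem moebius_cov_comp (ν : ℂ) {a : Fin r → Fin s} {b : Fin s → Fin t} (hb : b.Injective) :
    compDiagrams ν (moebius (Setoid.ker (Sum.elim a id))) (moebius (Setoid.ker (Sum.elim b id))) =
      moebius (Setoid.ker (Sum.elim (b ∘ a) id)) := by
  classical
  refine IsPolyFamily.ext
    (a := fun ν => compDiagrams ν (moebius (Setoid.ker (Sum.elim a id)))
      (moebius (Setoid.ker (Sum.elim b id))))
    (b := fun _ => moebius (Setoid.ker (Sum.elim (b ∘ a) id)))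
    ((IsPolyFamily.const _).comp (.const _)) (.const _) (fun n => ?_) ν
  rw [realize_comp]
  ext f g
  rw [Matrix.mul_apply]
  simp only [realize_moebius, elim_id_eq_ker]
  rw [Finset.sum_eq_single (g ∘ b)]
  · by_cases hg : g.Injective
    · simp [hg, hg.comp hb, Function.comp_assoc]
    · simp [hg]
  · intro h _ hh
    simp [hh]
  · simp

theorem moebius_con_comp (ν : ℂ) {a : Fin s → Fin r} {b : Fin t → Fin s} (ha : a.Injective) :
    compDiagrams ν (moebius (Setoid.ker (Sum.elim id a))) (moebius (Setoid.ker (Sum.elim id b))) =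
      moebius (Setoid.ker (Sum.elim id (a ∘ b))) := by
  classical
  refine IsPolyFamily.ext
    (a := fun ν => compDiagrams ν (moebius (Setoid.ker (Sum.elim id a)))
      (moebius (Setoid.ker (Sum.elim id b))))
    (b := fun _ => moebius (Setoid.ker (Sum.elim id (a ∘ b))))
    ((IsPolyFamily.const _).comp (.const _)) (.const _) (fun n => ?_) ν
  rw [realize_comp]
  ext f g
  rw [Matrix.mul_apply]
  simp only [realize_moebius, id_elim_eq_ker]
  rw [Finset.sum_eq_single (f ∘ a)]
  · by_cases hf : f.Injective
    · simp [hf, hf.comp ha, Function.comp_assoc]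
    · simp [hf]
  · intro h _ hh
    simp [hh]
  · simp

open scoped Classical in
theorem realize_smul (n : ℕ) (c : ℂ) (a : DiagramSpace r s) :
    realize n (c • a) = c • realize n a := by
  ext f g
  simp only [realize, Matrix.smul_apply, smul_eq_mul, Finset.mul_sum]
  refine Finset.sum_congr rfl fun π _ => ?_
  split_ifs <;> simp

/-- A cyclic permutation of the source moves position `l` to the front, where the statement is the
one for `Fin.cons`. -/
theorem insertNth_injective_iff {α : Type*} (l : Fin (k + 1)) (y : α) (f : Fin k → α) :
    (l.insertNth (α := fun _ => α) y f).Injective ↔ y ∉ Set.range f ∧ f.Injective := by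
  rw [← Fin.cons_injective_iff, ← Fin.insertNth_comp_cycleRange_symm l y f, Equiv.injective_comp]

/-- An injection extends to an injection at position `l` by any value outside of its range. -/
theorem sum_extensions (n : ℕ) (l : Fin (k + 1)) (f : Fin k → Fin n) (hf : f.Injective)
    [∀ g : Fin (k + 1) → Fin n, Decidable (f = g ∘ l.succAbove ∧ g.Injective)] :
    (∑ g : Fin (k + 1) → Fin n, if f = g ∘ l.succAbove ∧ g.Injective then (1 : ℂ) else 0) =
      n - k := by
  classical
  have h1 : (∑ g : Fin (k + 1) → Fin n,
      if f = g ∘ l.succAbove ∧ g.Injective then (1 : ℂ) else 0) =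
      ∑ y : Fin n, if y ∉ Set.range f then (1 : ℂ) else 0 := by
    -- A function on k + 1 points is its value at `l` together with its restriction to the rest. The
    -- restriction must be `f`, so only the value at `l` remains free.
    rw [← (Fin.insertNthEquiv (fun _ => Fin n) l).sum_comp, Fintype.sum_prod_type]
    refine Finset.sum_congr rfl fun y _ => ?_
    rw [Finset.sum_eq_single f]
    · refine if_congr ?_ rfl rfl
      have hc : f = l.insertNth (α := fun _ => Fin n) y f ∘ l.succAbove := by ext i; simp
      change f = l.insertNth (α := fun _ => Fin n) y f ∘ l.succAbove ∧ _ ↔ _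
      rw [← hc]
      exact ⟨fun h => ((insertNth_injective_iff l y f).1 h.2).1,
        fun h => ⟨rfl, (insertNth_injective_iff l y f).2 ⟨h, hf⟩⟩⟩
    · intro h _ hh
      rw [if_neg]
      rintro ⟨rfl, -⟩
      apply hh
      ext i; simp [Fin.insertNthEquiv]
    · simp
  rw [h1, ← Finset.sum_filter, Finset.sum_const, nsmul_one]
  have hc : (Finset.univ.filter fun y => y ∉ Set.range f) = (Finset.univ.image f)ᶜ := by
    ext; simp
  rw [hc, Finset.card_compl, Finset.card_image_of_injective _ hf]
  -- The injection itself supplies the inequality that makes the natural-number difference agree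
  -- with the complex one.
  have : k ≤ n := by simpa using Fintype.card_le_of_injective f hf
  simp [Nat.cast_sub this]

/-- The diagonal entry at an injection counts its extensions to position `l`, of which there are n -
k by `sum_extensions`. All other entries vanish, since both outer functions are the restriction of
the same intermediate function. -/
theorem moebius_resStar_comp_res_self (ν : ℂ) (l : Fin (k + 1)) :
    compDiagrams ν (moebius (resStarDiagram l)) (moebius (resDiagram l)) =
      (ν - k) • injProj k := by
  classical
  refine IsPolyFamily.ext
    (a := fun ν => compDiagrams ν (moebius (resStarDiagram l)) (moebius (resDiagram l)))
    (b := fun ν => (ν - k) • injProj k)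
    ((IsPolyFamily.const _).comp (.const _))
    (fun π => ⟨(Polynomial.X - Polynomial.C (k : ℂ)) * Polynomial.C (injProj k π), by simp⟩)
    (fun n => ?_) ν
  rw [realize_comp, realize_smul, realize_injProj]
  ext f g
  rw [Matrix.mul_apply]
  simp only [realize_moebius, elim_id_eq_ker, id_elim_eq_ker, Matrix.smul_apply,
    Matrix.diagonal_apply, mul_ite, mul_one, mul_zero, ← ite_and]
  by_cases hfg : f = g
  · subst hfg
    by_cases hf : f.Injective
    · refine Eq.trans (Finset.sum_congr rfl fun h _ => if_congr ?_ rfl rfl)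
        ((sum_extensions n l f hf).trans ?_)
      · tauto
      · simp [hf]
    · rw [Finset.sum_eq_zero]
      · simp [hf]
      · intro h _
        rw [if_neg]
        rintro ⟨⟨rfl, -⟩, -, hi⟩
        exact hf (hi.comp Fin.succAbove_right_injective)
  · rw [Finset.sum_eq_zero]
    · simp [hfg]
    · intro h _
      rw [if_neg]
      rintro ⟨⟨rfl, -⟩, rfl, -⟩
      exact hfg rfl

/-- Both composites relate injections `f` and `g` that agree after deleting position 0 of `f` and
position `j` of `g`. Inserting first also requires `f 0` to avoid every value of `g`; deleting first
allows `f 0 = g j`. This extra case is exactly the graph of the cyclic permutation that carries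
position 0 to `j`. -/
theorem moebius_resStar_succ_comp_res_zero (ν : ℂ) (j : Fin (k + 1)) :
    compDiagrams ν (moebius (resStarDiagram j.succ)) (moebius (resDiagram (0 : Fin (k + 2)))) =
      compDiagrams ν (moebius (resDiagram (0 : Fin (k + 1)))) (moebius (resStarDiagram j)) -
        moebius (permDiagram j.cycleRange.symm) := by
  classical
  refine IsPolyFamily.ext
    (a := fun ν => compDiagrams ν (moebius (resStarDiagram j.succ))
      (moebius (resDiagram (0 : Fin (k + 2)))))
    (b := fun ν => compDiagrams ν (moebius (resDiagram (0 : Fin (k + 1))))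
      (moebius (resStarDiagram j)) - moebius (permDiagram j.cycleRange.symm))
    ((IsPolyFamily.const _).comp (.const _)) (fun π => ?_) (fun n => ?_) ν
  · obtain ⟨p, hp⟩ := ((IsPolyFamily.const (moebius (resDiagram (0 : Fin (k + 1))))).comp
      (.const (moebius (resStarDiagram j)))) π
    exact ⟨p - Polynomial.C (moebius (permDiagram j.cycleRange.symm) π), fun ν => by simp [hp]⟩
  rw [realize_sub, realize_comp, realize_comp]
  ext f g
  rw [Matrix.sub_apply, Matrix.mul_apply, Matrix.mul_apply]
  simp only [realize_moebius, elim_id_eq_ker, id_elim_eq_ker, mul_ite, mul_one, mul_zero,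
    ← ite_and]
  -- Given that `g` is the tail of `h`, the condition linking `f` to `h` splits into its value at 0
  -- and a condition on `f` and `g` alone.
  have key : ∀ h : Fin (k + 2) → Fin n, g = h ∘ (0 : Fin (k + 2)).succAbove →
      (f = h ∘ j.succ.succAbove ↔ f 0 = h 0 ∧ f ∘ Fin.succ = g ∘ j.succAbove) := by
    rintro h rfl
    rw [funext_iff, Fin.forall_fin_succ, funext_iff]
    simp
  -- The intermediate function has tail `g` and head `f 0`, so it is unique; its injectivity is that
  -- of `g` together with `f 0` lying outside the range of `g`.
  have e1 : (∑ h : Fin (k + 2) → Fin n, if (g = h ∘ (0 : Fin (k + 2)).succAbove ∧ h.Injective) ∧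
        f = h ∘ j.succ.succAbove ∧ h.Injective then (1 : ℂ) else 0) =
      if f ∘ Fin.succ = g ∘ j.succAbove ∧ g.Injective ∧ f 0 ∉ Set.range g then 1 else 0 := by
    rw [Finset.sum_eq_single (Fin.cons (f 0) g)]
    · refine if_congr ?_ rfl rfl
      have h1 : g = (Fin.cons (f 0) g : Fin (k + 2) → Fin n) ∘ (0 : Fin (k + 2)).succAbove := by
        ext i; simp
      rw [key _ h1, Fin.cons_injective_iff]
      simp only [Fin.cons_zero, true_and]
      tauto
    · intro h _ hh
      rw [if_neg]
      rintro ⟨⟨h1, -⟩, h2, -⟩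
      apply hh
      rw [key _ h1] at h2
      ext i
      refine Fin.cases ?_ (fun i => ?_) i
      · simp [h2.1]
      · simp [h1]
    · simp
  have e2 : (∑ h : Fin k → Fin n, if (h = g ∘ j.succAbove ∧ g.Injective) ∧
        h = f ∘ (0 : Fin (k + 1)).succAbove ∧ f.Injective then (1 : ℂ) else 0) =
      if f ∘ Fin.succ = g ∘ j.succAbove ∧ g.Injective ∧ f.Injective then 1 else 0 := by
    have h0 : f ∘ (0 : Fin (k + 1)).succAbove = f ∘ Fin.succ := by ext i; simp
    rw [Finset.sum_eq_single (f ∘ Fin.succ)]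
    · refine if_congr ?_ rfl rfl
      rw [h0]
      tauto
    · intro h _ hh
      rw [if_neg]
      rw [h0]
      tauto
    · simp
  have e3 : f = g ∘ j.cycleRange.symm ↔ f 0 = g j ∧ f ∘ Fin.succ = g ∘ j.succAbove := by
    rw [funext_iff, Fin.forall_fin_succ, funext_iff]
    simp
  rw [e1, e2]
  simp only [e3]
  by_cases hA : f ∘ Fin.succ = g ∘ j.succAbove
  swap
  · simp [hA]
  by_cases hg : g.Injective
  swap
  · simp [hg]
  have hf : f.Injective ↔ ∀ i, g (j.succAbove i) ≠ f 0 := by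
    have : f = Fin.cons (f 0) (f ∘ Fin.succ) := by
      ext i; refine Fin.cases ?_ (fun i => ?_) i <;> simp
    rw [this, Fin.cons_injective_iff, hA]
    simp [hg.comp Fin.succAbove_right_injective]
  have hr : f 0 ∈ Set.range g ↔ f 0 = g j ∨ ∃ i, g (j.succAbove i) = f 0 := by
    rw [Set.mem_range, Fin.exists_iff_succAbove j, eq_comm]
  -- If `f 0 = g j`, then `f` is injective and the identity reads 0 = 1 - 1. Otherwise the
  -- permutation term vanishes, and `f 0` avoids the range of `g` exactly when `f` is injective.
  by_cases h0 : f 0 = g j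
  · have : ∀ i, g (j.succAbove i) ≠ g j := fun i h => Fin.succAbove_ne j i (hg h)
    simp [hA, hg, hf, h0, this]
  · simp [hA, hg, hf, hr, h0]

end DiagramIdentities
end DeligneSn

/-! ### Relations among `res`, `resStar` and permutations as morphisms between the Δ_k. -/

namespace DeligneSn

/-- A permutation carries the complement of `l` to the complement of `τ l`; relabelling both
complements in increasing order gives `τ'`. This compares the actions of the symmetric groups on k
and k + 1 letters. -/
theorem exists_perm_succAbove {k : ℕ} (τ : Equiv.Perm (Fin (k + 1))) (l : Fin (k + 1)) :
    ∃ τ' : Equiv.Perm (Fin k), ∀ i, τ (l.succAbove i) = (τ l).succAbove (τ' i) := by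
  have h : ∀ i, ∃ j, (τ l).succAbove j = τ (l.succAbove i) := fun i =>
    Fin.exists_succAbove_eq fun h => Fin.succAbove_ne l i (τ.injective h)
  choose t ht using h
  have hi : t.Injective := fun i j hij => by
    have := (ht i).symm.trans ((congrArg _ hij).trans (ht j))
    exact Fin.succAbove_right_injective (τ.injective this)
  exact ⟨Equiv.ofBijective t (Finite.injective_iff_bijective.1 hi), fun i => (ht i).symm⟩

theorem perm_symm_apply_apply {α : Type*} (τ : Equiv.Perm α) (x : α) : Equiv.symm τ (τ x) = x :=
  Equiv.symm_apply_apply _ _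

section DeltaIdentities

open CategoryTheory.Idempotents

variable (ν : ℂ) {r s t k : ℕ}

theorem hHom_add (a b : DiagramSpace r s) : hHom ν (a + b) = hHom ν a + hHom ν b :=
  (Mat_.embedding (HPower ν)).map_add (X := ⟨r⟩) (Y := ⟨s⟩) (f := a) (g := b)

theorem hHom_sub (a b : DiagramSpace r s) : hHom ν (a - b) = hHom ν a - hHom ν b := by
  rw [eq_sub_iff_add_eq, ← hHom_add, sub_add_cancel]

theorem hHom_smul (c : ℂ) (a : DiagramSpace r s) : hHom ν (c • a) = c • hHom ν a := rfl

theorem karoubi_sub_f {C : Type*} [Category C] [Preadditive C] {P Q : Karoubi C} (f g : P ⟶ Q) :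
    (f - g).f = f.f - g.f :=
  (Karoubi.inclusionHom P Q).map_sub f g

theorem deltaHom_comp_f {π : Diagram r s} {ρ : Diagram s t} (hπ : IsBar π) (hρ : IsBar ρ) :
    (deltaHom ν π hπ ≫ deltaHom ν ρ hρ).f = hHom ν (compDiagrams ν (moebius π) (moebius ρ)) :=
  hHom_comp _ _

theorem deltaHom_congr {π π' : Diagram r s} (h : π = π') (hπ : IsBar π) (hπ' : IsBar π') :
    deltaHom ν π hπ = deltaHom ν π' hπ' := by
  subst h; rfl

theorem deltaHom_cov_comp {a : Fin r → Fin s} {b : Fin s → Fin t} (ha : a.Injective)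
    (hb : b.Injective) :
    deltaHom ν _ (isBar_ker ha Function.injective_id) ≫
        deltaHom ν _ (isBar_ker hb Function.injective_id) =
      deltaHom ν _ (isBar_ker (hb.comp ha) Function.injective_id) := by
  apply Karoubi.hom_ext
  rw [deltaHom_comp_f, moebius_cov_comp ν hb]
  rfl

theorem deltaHom_con_comp {a : Fin s → Fin r} {b : Fin t → Fin s} (ha : a.Injective)
    (hb : b.Injective) :
    deltaHom ν _ (isBar_ker Function.injective_id ha) ≫
        deltaHom ν _ (isBar_ker Function.injective_id hb) =
      deltaHom ν _ (isBar_ker Function.injective_id (ha.comp hb)) := by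
  apply Karoubi.hom_ext
  rw [deltaHom_comp_f, moebius_con_comp ν ha]
  rfl

theorem permDelta_eq (σ : Equiv.Perm (Fin k)) :
    permDelta ν σ = deltaHom ν _ (isBar_ker Function.injective_id σ.symm.injective) :=
  deltaHom_congr ν (permDiagram_eq_elim_symm σ) _ _

theorem resStar_comp_permDelta {τ : Equiv.Perm (Fin (k + 1))} {τ' : Equiv.Perm (Fin k)}
    {l : Fin (k + 1)} (h : ∀ i, τ (l.succAbove i) = (τ l).succAbove (τ' i)) :
    resStar ν l ≫ permDelta ν τ = permDelta ν τ' ≫ resStar ν (τ l) := by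
  rw [resStar, permDelta, permDelta, resStar,
    deltaHom_cov_comp ν Fin.succAbove_right_injective τ.injective,
    deltaHom_cov_comp ν τ'.injective Fin.succAbove_right_injective]
  refine deltaHom_congr ν ?_ _ _
  rw [show τ ∘ l.succAbove = (τ l).succAbove ∘ τ' from funext h]

theorem permDelta_comp_res {τ : Equiv.Perm (Fin (k + 1))} {τ' : Equiv.Perm (Fin k)}
    {l : Fin (k + 1)} (h : ∀ i, τ (l.succAbove i) = (τ l).succAbove (τ' i)) :
    permDelta ν τ ≫ res ν (τ l) = res ν l ≫ permDelta ν τ' := by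
  rw [permDelta_eq, permDelta_eq, res, res,
    deltaHom_con_comp ν τ.symm.injective Fin.succAbove_right_injective,
    deltaHom_con_comp ν Fin.succAbove_right_injective τ'.symm.injective]
  refine deltaHom_congr ν ?_ _ _
  rw [show τ.symm ∘ (τ l).succAbove = l.succAbove ∘ τ'.symm from funext fun i => by
    rw [Function.comp_apply, Equiv.symm_apply_eq, Function.comp_apply, h,
      Equiv.apply_symm_apply]]

theorem succAbove_comp_succAbove (l : Fin (k + 1)) (m : Fin (k + 2)) :
    m.succAbove ∘ l.succAbove = (m.succAbove l).succAbove ∘ (l.predAbove m).succAbove :=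
  funext fun i => (Fin.succAbove_succAbove_succAbove_predAbove m l i).symm

/-- This is the coface identity: both sides are the diagram of the increasing injection that omits
the same two positions, filled in the two possible orders. -/
theorem resStar_comp_resStar (l : Fin (k + 1)) (m : Fin (k + 2)) :
    resStar ν l ≫ resStar ν m = resStar ν (l.predAbove m) ≫ resStar ν (m.succAbove l) := by
  have hi : ∀ {n : ℕ} (i : Fin (n + 1)), i.succAbove.Injective :=
    fun _ => Fin.succAbove_right_injective
  rw [resStar, resStar, resStar, resStar, deltaHom_cov_comp ν (hi l) (hi m),
    deltaHom_cov_comp ν (hi _) (hi _)]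
  refine deltaHom_congr ν ?_ _ _
  rw [succAbove_comp_succAbove]

theorem res_comp_res (l : Fin (k + 1)) (m : Fin (k + 2)) :
    res ν m ≫ res ν l = res ν (m.succAbove l) ≫ res ν (l.predAbove m) := by
  have hi : ∀ {n : ℕ} (i : Fin (n + 1)), i.succAbove.Injective :=
    fun _ => Fin.succAbove_right_injective
  rw [res, res, res, res, deltaHom_con_comp ν (hi m) (hi l),
    deltaHom_con_comp ν (hi _) (hi _)]
  refine deltaHom_congr ν ?_ _ _
  rw [succAbove_comp_succAbove]

theorem resStar_comp_res_self (l : Fin (k + 1)) :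
    resStar ν l ≫ res ν l = (ν - k) • 𝟙 (Delta ν k) := by
  apply Karoubi.hom_ext
  rw [resStar, res, deltaHom_comp_f, moebius_resStar_comp_res_self, hHom_smul]
  rfl

theorem resStar_succ_comp_res_zero (j : Fin (k + 1)) :
    resStar ν j.succ ≫ res ν 0 =
      res ν 0 ≫ resStar ν j - permDelta ν j.cycleRange.symm := by
  apply Karoubi.hom_ext
  rw [karoubi_sub_f, resStar, res, deltaHom_comp_f, moebius_resStar_succ_comp_res_zero, hHom_sub,
    res, resStar, deltaHom_comp_f]
  rfl

end DeltaIdentities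

/-! ### The parallel relations for tensor powers of U. -/

section TensorIdentities

open TensorProduct

variable {U : Type*} [AddCommGroup U] [Module ℂ U] {k : ℕ}

theorem tensorPower_hom_ext {W : Type*} [AddCommMonoid W] [Module ℂ W]
    {f g : (⨂[ℂ]^k U) →ₗ[ℂ] W}
    (h : ∀ v : Fin k → U, f (PiTensorProduct.tprod ℂ v) = g (PiTensorProduct.tprod ℂ v)) :
    f = g :=
  PiTensorProduct.ext (MultilinearMap.ext h)

theorem factorAction_tprod (A : Module.End ℂ U) (i : Fin k) (v : Fin k → U) :
    factorAction A i (PiTensorProduct.tprod ℂ v) =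
      PiTensorProduct.tprod ℂ (Function.update v i (A (v i))) := by
  rw [factorAction, PiTensorProduct.map_tprod]
  congr 1
  ext j
  by_cases h : j = i
  · subst h; simp
  · simp [h]

theorem permFactors_comp_insertFactor (u : U) {τ : Equiv.Perm (Fin (k + 1))}
    {τ' : Equiv.Perm (Fin k)} {l : Fin (k + 1)}
    (h : ∀ i, τ (l.succAbove i) = (τ l).succAbove (τ' i)) :
    permFactors τ ∘ₗ insertFactor u l = insertFactor u (τ l) ∘ₗ permFactors τ' := by
  refine tensorPower_hom_ext fun v => ?_
  simp only [LinearMap.comp_apply, insertFactor_tprod,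
    permFactors_tprod]
  congr 1
  ext i
  obtain ⟨i, rfl⟩ := τ.surjective i
  rcases Fin.eq_self_or_eq_succAbove l i with rfl | ⟨j, rfl⟩
  · simp
  · rw [perm_symm_apply_apply, h]
    simp

theorem contractFactor_comp_permFactors (f : Module.Dual ℂ U) {τ : Equiv.Perm (Fin (k + 1))}
    {τ' : Equiv.Perm (Fin k)} {l : Fin (k + 1)}
    (h : ∀ i, τ (l.succAbove i) = (τ l).succAbove (τ' i)) :
    contractFactor f (τ l) ∘ₗ permFactors τ = permFactors τ' ∘ₗ contractFactor f l := by
  refine tensorPower_hom_ext fun v => ?_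
  simp only [LinearMap.comp_apply, contractFactor_tprod,
    permFactors_tprod, map_smul, perm_symm_apply_apply]
  refine congrArg _ (congrArg _ (funext fun i => ?_))
  obtain ⟨i, rfl⟩ := τ'.surjective i
  rw [← h, perm_symm_apply_apply, perm_symm_apply_apply]

theorem permFactors_comp_factorAction (A : Module.End ℂ U) (τ : Equiv.Perm (Fin k)) (i : Fin k) :
    permFactors τ ∘ₗ factorAction A i = factorAction A (τ i) ∘ₗ permFactors τ := by
  refine tensorPower_hom_ext fun v => ?_
  simp only [LinearMap.comp_apply, factorAction_tprod,
    permFactors_tprod]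
  congr 1
  ext j
  obtain ⟨j, rfl⟩ := τ.surjective j
  by_cases h : j = i
  · subst h; simp
  · simp [h]

theorem insertFactor_comp_insertFactor (u u' : U) (l : Fin (k + 1)) (m : Fin (k + 2)) :
    insertFactor u m ∘ₗ insertFactor u' l =
      insertFactor u' (m.succAbove l) ∘ₗ insertFactor u (l.predAbove m) := by
  refine tensorPower_hom_ext fun v => ?_
  simp only [LinearMap.comp_apply, insertFactor_tprod]
  congr 1
  ext i
  rcases Fin.eq_self_or_eq_succAbove m i with h | ⟨j, rfl⟩
  · rw [h, Fin.insertNth_apply_same]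
    have h := Fin.insertNth_apply_succAbove (α := fun _ => U) (m.succAbove l) u'
      ((l.predAbove m).insertNth u v) (l.predAbove m)
    rw [Fin.succAbove_succAbove_predAbove] at h
    rw [h, Fin.insertNth_apply_same]
  · rcases Fin.eq_self_or_eq_succAbove l j with rfl | ⟨n, rfl⟩
    · simp
    · rw [Fin.insertNth_apply_succAbove, Fin.insertNth_apply_succAbove,
        ← Fin.succAbove_succAbove_succAbove_predAbove, Fin.insertNth_apply_succAbove,
        Fin.insertNth_apply_succAbove]

theorem contractFactor_comp_contractFactor (f f' : Module.Dual ℂ U) (l : Fin (k + 1))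
    (m : Fin (k + 2)) :
    contractFactor f' l ∘ₗ contractFactor f m =
      contractFactor f (l.predAbove m) ∘ₗ contractFactor f' (m.succAbove l) := by
  refine tensorPower_hom_ext fun v => ?_
  simp only [LinearMap.comp_apply, contractFactor_tprod,
    map_smul]
  rw [smul_comm, Fin.succAbove_succAbove_predAbove]
  refine congrArg _ (congrArg _ (congrArg _ (funext fun i => ?_)))
  rw [Fin.succAbove_succAbove_succAbove_predAbove]

theorem contractFactor_comp_insertFactor_self (f : Module.Dual ℂ U) (u : U) (l : Fin (k + 1)) :
    contractFactor f l ∘ₗ insertFactor u l = f u • LinearMap.id := by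
  refine tensorPower_hom_ext fun v => ?_
  simp [insertFactor_tprod, contractFactor_tprod]

/-- The contracted factor at position 0 lies before the inserted one, so the two operations do not
meet; removing position 0 only shifts the insertion from j + 1 to j. -/
theorem contractFactor_zero_comp_insertFactor_succ (f : Module.Dual ℂ U) (u : U)
    (j : Fin (k + 1)) :
    contractFactor f 0 ∘ₗ insertFactor u j.succ = insertFactor u j ∘ₗ contractFactor f 0 := by
  refine tensorPower_hom_ext fun v => ?_
  simp only [LinearMap.comp_apply, insertFactor_tprod,
    contractFactor_tprod, map_smul]
  refine congrArg₂ (· • ·) (congrArg f ?_) (congrArg _ (funext fun i => ?_))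
  · exact Fin.insertNth_apply_succAbove (α := fun _ => U) j.succ u v 0
  · rcases Fin.eq_self_or_eq_succAbove j i with rfl | ⟨i, rfl⟩
    · simp
    · have : (0 : Fin (k + 2)).succAbove (j.succAbove i) = j.succ.succAbove i.succ := by simp
      rw [this, Fin.insertNth_apply_succAbove, Fin.insertNth_apply_succAbove]
      simp

/-- Instead of consuming the factor at 0 and putting `u` at `j`, one may carry that factor to
position `j` and there replace it by its image under w ↦ f(w)u. The carrying permutation is the one
in `resStar_succ_comp_res_zero`, which is what turns the correction on the Δ side into
T_{f,u}^{(j)}. -/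
theorem insertFactor_comp_contractFactor_zero (f : Module.Dual ℂ U) (u : U)
    (j : Fin (k + 1)) :
    insertFactor u j ∘ₗ contractFactor f 0 =
      factorAction (f.smulRight u) j ∘ₗ permFactors j.cycleRange.symm := by
  refine tensorPower_hom_ext fun v => ?_
  simp only [LinearMap.comp_apply, insertFactor_tprod,
    contractFactor_tprod, map_smul, permFactors_tprod, factorAction_tprod, Equiv.symm_symm,
    LinearMap.smulRight_apply, MultilinearMap.map_update_smul]
  rw [Fin.cycleRange_self]
  refine congrArg _ (congrArg _ (funext fun i => ?_))
  rcases Fin.eq_self_or_eq_succAbove j i with rfl | ⟨i, rfl⟩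
  · simp
  · simp [Fin.succAbove_ne]

theorem factorAction_comp_insertFactor_self (A : Module.End ℂ U) (u : U) (l : Fin (k + 1)) :
    factorAction A l ∘ₗ insertFactor u l = insertFactor (A u) l := by
  refine tensorPower_hom_ext fun v => ?_
  simp only [LinearMap.comp_apply, insertFactor_tprod,
    factorAction_tprod]
  congr 1
  ext i
  rcases Fin.eq_self_or_eq_succAbove l i with rfl | ⟨i, rfl⟩
  · simp
  · simp [Fin.succAbove_ne]

theorem factorAction_succAbove_comp_insertFactor (A : Module.End ℂ U) (u : U) (l : Fin (k + 1))
    (i : Fin k) :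
    factorAction A (l.succAbove i) ∘ₗ insertFactor u l = insertFactor u l ∘ₗ factorAction A i := by
  refine tensorPower_hom_ext fun v => ?_
  simp only [LinearMap.comp_apply, insertFactor_tprod,
    factorAction_tprod]
  congr 1
  ext j
  rcases Fin.eq_self_or_eq_succAbove l j with rfl | ⟨j, rfl⟩
  · simp [Fin.ne_succAbove]
  · by_cases h : j = i
    · subst h; simp
    · simp [h]

theorem contractFactor_comp_factorAction_self (f : Module.Dual ℂ U) (A : Module.End ℂ U)
    (l : Fin (k + 1)) :
    contractFactor f l ∘ₗ factorAction A l = contractFactor (f ∘ₗ A) l := by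
  refine tensorPower_hom_ext fun v => ?_
  simp only [LinearMap.comp_apply, contractFactor_tprod,
    factorAction_tprod, Function.update_self]
  congr 2
  ext i
  simp [Fin.succAbove_ne]

theorem contractFactor_comp_factorAction_succAbove (f : Module.Dual ℂ U) (A : Module.End ℂ U)
    (l : Fin (k + 1)) (i : Fin k) :
    contractFactor f l ∘ₗ factorAction A (l.succAbove i) =
      factorAction A i ∘ₗ contractFactor f l := by
  refine tensorPower_hom_ext fun v => ?_
  simp only [LinearMap.comp_apply, contractFactor_tprod,
    factorAction_tprod, map_smul, Function.update_of_ne (Fin.ne_succAbove l i)]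
  congr 2
  ext j
  by_cases h : j = i
  · subst h; simp
  · simp [h]

theorem factorAction_comp_self (A B : Module.End ℂ U) (i : Fin k) :
    factorAction A i ∘ₗ factorAction B i = factorAction (A ∘ₗ B) i := by
  refine tensorPower_hom_ext fun v => ?_
  simp [factorAction_tprod]

theorem factorAction_comp_of_ne (A B : Module.End ℂ U) {i j : Fin k} (h : i ≠ j) :
    factorAction A i ∘ₗ factorAction B j = factorAction B j ∘ₗ factorAction A i := by
  refine tensorPower_hom_ext fun v => ?_
  simp only [LinearMap.comp_apply, factorAction_tprod,
    Function.update_of_ne h, Function.update_of_ne h.symm]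
  rw [Function.update_comm h]

theorem factorAction_id (i : Fin k) : factorAction (LinearMap.id : U →ₗ[ℂ] U) i = LinearMap.id := by
  refine tensorPower_hom_ext fun v => ?_
  simp [factorAction_tprod]

theorem factorAction_add (A B : Module.End ℂ U) (i : Fin k) :
    factorAction (A + B) i = factorAction A i + factorAction B i := by
  refine tensorPower_hom_ext fun v => ?_
  simp [factorAction_tprod]

theorem factorAction_smul (c : ℂ) (A : Module.End ℂ U) (i : Fin k) :
    factorAction (c • A) i = c • factorAction A i := by
  refine tensorPower_hom_ext fun v => ?_
  simp [factorAction_tprod]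

theorem insertFactor_add (u u' : U) (l : Fin (k + 1)) :
    insertFactor (u + u') l = insertFactor u l + insertFactor u' l := by
  simp [insertFactor]

theorem insertFactor_smul (c : ℂ) (u : U) (l : Fin (k + 1)) :
    insertFactor (c • u) l = c • insertFactor u l := by
  simp [insertFactor]

theorem contractFactor_add (f f' : Module.Dual ℂ U) (l : Fin (k + 1)) :
    contractFactor (f + f') l = contractFactor f l + contractFactor f' l := by
  refine tensorPower_hom_ext fun v => ?_
  simp [contractFactor_tprod, add_smul]

theorem contractFactor_smul (c : ℂ) (f : Module.Dual ℂ U) (l : Fin (k + 1)) :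
    contractFactor (c • f) l = c • contractFactor f l := by
  refine tensorPower_hom_ext fun v => ?_
  simp [contractFactor_tprod, mul_smul]

end TensorIdentities
end DeligneSn

namespace DeligneSn

/-! ### Bilinearity of the construction A ⊗ φ. -/

section VtensorLinear

theorem vtensor_hom_ext {D : Type*} [Category D] [Preadditive D] [HasFiniteBiproducts D]
    {W W' : Type*} [AddCommGroup W] [Module ℂ W] [Module.Finite ℂ W]
    [AddCommGroup W'] [Module ℂ W'] [Module.Finite ℂ W'] {X Y : D}
    {f g : vtensor W X ⟶ vtensor W' Y}
    (h : ∀ i j, biproduct.ι (fun _ => X) i ≫ f ≫ biproduct.π (fun _ => Y) j =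
      biproduct.ι (fun _ => X) i ≫ g ≫ biproduct.π (fun _ => Y) j) : f = g := by
  apply biproduct.hom_ext'
  intro i
  apply biproduct.hom_ext
  intro j
  simpa using h i j

variable {D : Type*} [Category D] [Preadditive D] [Linear ℂ D] [HasFiniteBiproducts D]
  {W W' : Type*} [AddCommGroup W] [Module ℂ W] [Module.Finite ℂ W]
  [AddCommGroup W'] [Module ℂ W'] [Module.Finite ℂ W'] {X Y : D}

theorem ι_vtensorMap_π (A : W →ₗ[ℂ] W') (φ : X ⟶ Y) (i : Fin (Module.finrank ℂ W))
    (j : Fin (Module.finrank ℂ W')) :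
    biproduct.ι (fun _ => X) i ≫ vtensorMap A φ ≫ biproduct.π (fun _ => Y) j =
      LinearMap.toMatrix (Module.finBasis ℂ W) (Module.finBasis ℂ W') A j i • φ := by
  simp [vtensorMap]

theorem vtensorMap_add_left (A B : W →ₗ[ℂ] W') (φ : X ⟶ Y) :
    vtensorMap (A + B) φ = vtensorMap A φ + vtensorMap B φ := by
  apply vtensor_hom_ext
  intro i j
  simp only [Preadditive.add_comp, Preadditive.comp_add, ι_vtensorMap_π, map_add,
    Matrix.add_apply, add_smul]

theorem vtensorMap_smul_left (c : ℂ) (A : W →ₗ[ℂ] W') (φ : X ⟶ Y) :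
    vtensorMap (c • A) φ = c • vtensorMap A φ := by
  apply vtensor_hom_ext
  intro i j
  simp only [Linear.smul_comp, Linear.comp_smul, ι_vtensorMap_π, map_smul,
    Matrix.smul_apply, smul_eq_mul, mul_smul]

theorem vtensorMap_sub_right (A : W →ₗ[ℂ] W') (φ ψ : X ⟶ Y) :
    vtensorMap A (φ - ψ) = vtensorMap A φ - vtensorMap A ψ := by
  apply vtensor_hom_ext
  intro i j
  simp only [Preadditive.sub_comp, Preadditive.comp_sub, ι_vtensorMap_π, smul_sub]

theorem vtensorMap_smul_right (c : ℂ) (A : W →ₗ[ℂ] W') (φ : X ⟶ Y) :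
    vtensorMap A (c • φ) = c • vtensorMap A φ := by
  apply vtensor_hom_ext
  intro i j
  simp only [Linear.smul_comp, Linear.comp_smul, ι_vtensorMap_π, smul_comm c]

end VtensorLinear

theorem sum_comp_sum {D : Type*} [Category D] [Preadditive D] {X Y Z : D} {ι κ : Type*} [Fintype ι]
    [Fintype κ] (a : ι → (X ⟶ Y)) (b : κ → (Y ⟶ Z)) :
    (∑ i, a i) ≫ (∑ j, b j) = ∑ p : ι × κ, a p.1 ≫ b p.2 := by
  rw [Preadditive.sum_comp, Fintype.sum_prod_type]
  simp only [Preadditive.comp_sum]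

/-- Interchanging the order of two successive insertions of a factor. -/
def swapInsertions (k : ℕ) : Fin (k + 1) × Fin (k + 2) ≃ Fin (k + 1) × Fin (k + 2) where
  toFun p := (p.1.predAbove p.2, p.2.succAbove p.1)
  invFun p := (p.1.predAbove p.2, p.2.succAbove p.1)
  left_inv p := by
    simp [Fin.succAbove_succAbove_predAbove, Fin.predAbove_predAbove_succAbove]
  right_inv p := by
    simp [Fin.succAbove_succAbove_predAbove, Fin.predAbove_predAbove_succAbove]

/-! ### The summands of F_u, E_f and the gl(U)-action on U^{⊗ k} ⊗ Δ_k. -/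

section Operators

variable (ν : ℂ) {U : Type*} [AddCommGroup U] [Module ℂ U] [Module.Finite ℂ U] {k : ℕ}

/-- The morphism `u^{(l)} ⊗ res_l^*`. -/
noncomputable def insDelta (u : U) (l : Fin (k + 1)) : UDelta ν U k ⟶ UDelta ν U (k + 1) :=
  vtensorMap (insertFactor u l) (resStar ν l)

/-- The morphism `f^{(l)} ⊗ res_l`. -/
noncomputable def conDelta (f : Module.Dual ℂ U) (l : Fin (k + 1)) : UDelta ν U (k + 1) ⟶ UDelta ν U k :=
  vtensorMap (contractFactor f l) (res ν l)

/-- The morphism `A^{(i)} ⊗ id`. -/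
noncomputable def actDelta (A : Module.End ℂ U) (i : Fin k) : UDelta ν U k ⟶ UDelta ν U k :=
  vtensorMap (factorAction A i) (𝟙 (Delta ν k))

theorem opF_eq (u : U) : opF ν u k = ((k : ℂ) + 1)⁻¹ • ∑ l, insDelta ν u l := rfl
theorem opE_eq (f : Module.Dual ℂ U) : opE ν f k = ∑ l, conDelta ν f l := rfl
theorem opA_eq (A : Module.End ℂ U) : opA ν A k = ∑ i, actDelta ν A i := rfl

theorem insDelta_comp_symAction (u : U) {τ : Equiv.Perm (Fin (k + 1))} {τ' : Equiv.Perm (Fin k)}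
    {l : Fin (k + 1)} (h : ∀ i, τ (l.succAbove i) = (τ l).succAbove (τ' i)) :
    insDelta ν u l ≫ symAction ν U (k + 1) τ = symAction ν U k τ' ≫ insDelta ν u (τ l) := by
  simp only [insDelta, symAction, vtensorMap_comp, permFactors_comp_insertFactor u h,
    resStar_comp_permDelta ν h]

theorem symAction_comp_conDelta (f : Module.Dual ℂ U) {τ : Equiv.Perm (Fin (k + 1))}
    {τ' : Equiv.Perm (Fin k)} {l : Fin (k + 1)}
    (h : ∀ i, τ (l.succAbove i) = (τ l).succAbove (τ' i)) :
    symAction ν U (k + 1) τ ≫ conDelta ν f (τ l) = conDelta ν f l ≫ symAction ν U k τ' := by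
  simp only [conDelta, symAction, vtensorMap_comp, contractFactor_comp_permFactors f h,
    permDelta_comp_res ν h]

theorem actDelta_comp_symAction (A : Module.End ℂ U) (τ : Equiv.Perm (Fin k)) (i : Fin k) :
    actDelta ν A i ≫ symAction ν U k τ = symAction ν U k τ ≫ actDelta ν A (τ i) := by
  simp only [actDelta, symAction, vtensorMap_comp, permFactors_comp_factorAction,
    Category.id_comp, Category.comp_id]

theorem insDelta_comp_insDelta (u u' : U) (l : Fin (k + 1)) (m : Fin (k + 2)) :
    insDelta ν u' l ≫ insDelta ν u m =
      insDelta ν u (l.predAbove m) ≫ insDelta ν u' (m.succAbove l) := by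
  simp only [insDelta, vtensorMap_comp, insertFactor_comp_insertFactor u u' l m,
    resStar_comp_resStar ν l m]

theorem conDelta_comp_conDelta (f f' : Module.Dual ℂ U) (l : Fin (k + 1)) (m : Fin (k + 2)) :
    conDelta ν f m ≫ conDelta ν f' l =
      conDelta ν f' (m.succAbove l) ≫ conDelta ν f (l.predAbove m) := by
  simp only [conDelta, vtensorMap_comp, contractFactor_comp_contractFactor f f' l m,
    res_comp_res ν l m]

theorem insDelta_comp_conDelta_self (f : Module.Dual ℂ U) (u : U) (l : Fin (k + 1)) :
    insDelta ν u l ≫ conDelta ν f l = ((ν - k) * f u) • 𝟙 (UDelta ν U k) := by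
  rw [insDelta, conDelta, vtensorMap_comp, contractFactor_comp_insertFactor_self,
    resStar_comp_res_self, vtensorMap_smul_left, vtensorMap_smul_right, vtensorMap_id, smul_smul,
    mul_comm]

/-- The correction from the Δ side and the cyclic permutation from the tensor side combine into one
diagonal group element followed by T_{f,u}^{(j)}. The group element disappears after restriction to
invariants. -/
theorem insDelta_succ_comp_conDelta_zero (f : Module.Dual ℂ U) (u : U) (j : Fin (k + 1)) :
    insDelta ν u j.succ ≫ conDelta ν f 0 = conDelta ν f 0 ≫ insDelta ν u j -
      symAction ν U (k + 1) j.cycleRange.symm ≫ actDelta ν (f.smulRight u) j := by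
  simp only [insDelta, conDelta, symAction, actDelta, vtensorMap_comp]
  rw [contractFactor_zero_comp_insertFactor_succ, resStar_succ_comp_res_zero,
    vtensorMap_sub_right, insertFactor_comp_contractFactor_zero, Category.comp_id]

theorem insDelta_comp_actDelta_self (A : Module.End ℂ U) (u : U) (l : Fin (k + 1)) :
    insDelta ν u l ≫ actDelta ν A l = insDelta ν (A u) l := by
  rw [insDelta, actDelta, vtensorMap_comp, factorAction_comp_insertFactor_self, Category.comp_id]
  rfl

theorem insDelta_comp_actDelta_succAbove (A : Module.End ℂ U) (u : U) (l : Fin (k + 1))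
    (i : Fin k) :
    insDelta ν u l ≫ actDelta ν A (l.succAbove i) = actDelta ν A i ≫ insDelta ν u l := by
  simp only [insDelta, actDelta, vtensorMap_comp, factorAction_succAbove_comp_insertFactor,
    Category.comp_id, Category.id_comp]

theorem actDelta_comp_conDelta_self (A : Module.End ℂ U) (f : Module.Dual ℂ U)
    (l : Fin (k + 1)) :
    actDelta ν A l ≫ conDelta ν f l = conDelta ν (f ∘ₗ A) l := by
  rw [conDelta, actDelta, vtensorMap_comp, contractFactor_comp_factorAction_self,
    Category.id_comp]
  rfl

theorem actDelta_succAbove_comp_conDelta (A : Module.End ℂ U) (f : Module.Dual ℂ U)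
    (l : Fin (k + 1)) (i : Fin k) :
    actDelta ν A (l.succAbove i) ≫ conDelta ν f l = conDelta ν f l ≫ actDelta ν A i := by
  simp only [conDelta, actDelta, vtensorMap_comp, contractFactor_comp_factorAction_succAbove,
    Category.comp_id, Category.id_comp]

theorem actDelta_comp_self (A B : Module.End ℂ U) (i : Fin k) :
    actDelta ν B i ≫ actDelta ν A i = actDelta ν (A * B) i := by
  simp only [actDelta, vtensorMap_comp, factorAction_comp_self, Category.comp_id]
  rfl

theorem actDelta_comp_of_ne (A B : Module.End ℂ U) {i j : Fin k} (h : i ≠ j) :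
    actDelta ν A i ≫ actDelta ν B j = actDelta ν B j ≫ actDelta ν A i := by
  simp only [actDelta, vtensorMap_comp, factorAction_comp_of_ne A B h, Category.comp_id]

/-- Separates the position `l` where an operator A^{(i)} meets an insertion or contraction from
those where it passes through unchanged. -/
theorem sum_succAbove {M : Type*} [AddCommMonoid M] (g : Fin (k + 1) → M) (l : Fin (k + 1)) :
    ∑ i, g i = (∑ i, g (l.succAbove i)) + g l := by
  rw [Fin.sum_univ_succAbove _ l, add_comm]

/-- The normalizing scalars agree on both sides, and `swapInsertions` matches the terms pairwise.
Passing to invariants is not needed here. -/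
theorem opF_comm (u u' : U) (k : ℕ) :
    opF ν u k ≫ opF ν u' (k + 1) = opF ν u' k ≫ opF ν u (k + 1) := by
  simp only [opF_eq, Linear.smul_comp, Linear.comp_smul]
  rw [sum_comp_sum, sum_comp_sum]
  refine congrArg _ (congrArg _ ?_)
  refine Fintype.sum_equiv (swapInsertions k) _ _ fun p => ?_
  exact insDelta_comp_insDelta ν u' u p.1 p.2

theorem opE_comm (f f' : Module.Dual ℂ U) (k : ℕ) :
    opE ν f (k + 1) ≫ opE ν f' k = opE ν f' (k + 1) ≫ opE ν f k := by
  rw [opE_eq, opE_eq, opE_eq, opE_eq, sum_comp_sum, sum_comp_sum]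
  refine Fintype.sum_equiv ((Equiv.prodComm _ _).trans ((swapInsertions k).trans
    (Equiv.prodComm _ _))) _ _ fun p => ?_
  exact conDelta_comp_conDelta ν f f' p.2 p.1

theorem opF_comp_opA (A : Module.End ℂ U) (u : U) (k : ℕ) :
    opF ν u k ≫ opA ν A (k + 1) = opA ν A k ≫ opF ν u k + opF ν (A u) k := by
  rw [opF_eq, opF_eq, opA_eq, opA_eq, Linear.smul_comp, Linear.comp_smul, ← smul_add,
    Preadditive.sum_comp, Preadditive.comp_sum, ← Finset.sum_add_distrib]
  refine congrArg _ (Finset.sum_congr rfl fun l _ => ?_)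
  rw [Preadditive.comp_sum, Preadditive.sum_comp, sum_succAbove _ l, insDelta_comp_actDelta_self]
  simp only [insDelta_comp_actDelta_succAbove]

theorem opA_comp_opE (A : Module.End ℂ U) (f : Module.Dual ℂ U) (k : ℕ) :
    opA ν A (k + 1) ≫ opE ν f k = opE ν f k ≫ opA ν A k + opE ν (f ∘ₗ A) k := by
  rw [opE_eq, opE_eq, opA_eq, opA_eq, Preadditive.comp_sum, Preadditive.sum_comp,
    ← Finset.sum_add_distrib]
  refine Finset.sum_congr rfl fun l _ => ?_
  rw [Preadditive.comp_sum, Preadditive.sum_comp, sum_succAbove _ l, actDelta_comp_conDelta_self]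
  simp only [actDelta_succAbove_comp_conDelta]

/-- Actions on different factors commute, so only the diagonal terms contribute to the commutator.
-/
theorem opA_mul (A B : Module.End ℂ U) (k : ℕ) :
    opA ν B k ≫ opA ν A k - opA ν A k ≫ opA ν B k = opA ν (A * B) k - opA ν (B * A) k := by
  rw [opA_eq, opA_eq, opA_eq, opA_eq, Preadditive.sum_comp, Preadditive.comp_sum,
    ← Finset.sum_sub_distrib, ← Finset.sum_sub_distrib]
  refine Finset.sum_congr rfl fun i _ => ?_
  rw [Preadditive.sum_comp, Preadditive.comp_sum, ← Finset.sum_sub_distrib,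
    Finset.sum_eq_single i, actDelta_comp_self, actDelta_comp_self]
  · intro j _ hj
    rw [actDelta_comp_of_ne ν B A hj.symm, sub_self]
  · simp

/-- The identity of U acts as the degree operator; this is how the k in ν - k becomes part of the
gl(V)-action. -/
theorem opA_id (k : ℕ) : opA ν (LinearMap.id : U →ₗ[ℂ] U) k = (k : ℂ) • 𝟙 (UDelta ν U k) := by
  simp only [opA, factorAction_id, vtensorMap_id, Finset.sum_const, Finset.card_univ,
    Fintype.card_fin, Nat.cast_smul_eq_nsmul]

theorem opF_add (u u' : U) (k : ℕ) : opF ν (u + u') k = opF ν u k + opF ν u' k := by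
  simp only [opF, insertFactor_add, vtensorMap_add_left, Finset.sum_add_distrib, smul_add]

theorem opF_smul (c : ℂ) (u : U) (k : ℕ) : opF ν (c • u) k = c • opF ν u k := by
  simp only [opF, insertFactor_smul, vtensorMap_smul_left, ← Finset.smul_sum, smul_comm c]

theorem opE_add (f f' : Module.Dual ℂ U) (k : ℕ) : opE ν (f + f') k = opE ν f k + opE ν f' k := by
  simp only [opE, contractFactor_add, vtensorMap_add_left, Finset.sum_add_distrib]

theorem opE_smul (c : ℂ) (f : Module.Dual ℂ U) (k : ℕ) : opE ν (c • f) k = c • opE ν f k := by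
  simp only [opE, contractFactor_smul, vtensorMap_smul_left, Finset.smul_sum]

theorem opA_add (A B : Module.End ℂ U) (k : ℕ) : opA ν (A + B) k = opA ν A k + opA ν B k := by
  simp only [opA, factorAction_add, vtensorMap_add_left, Finset.sum_add_distrib]

theorem opA_smul (c : ℂ) (A : Module.End ℂ U) (k : ℕ) : opA ν (c • A) k = c • opA ν A k := by
  simp only [opA, factorAction_smul, vtensorMap_smul_left, Finset.smul_sum]

end Operators

/-! ### Restriction to the invariants and the commutator of E_f and F_u. -/

section Invariants

variable (ν : ℂ) {U : Type*} [AddCommGroup U] [Module ℂ U] [Module.Finite ℂ U]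

theorem symAction_one (k : ℕ) : symAction ν U k 1 = 𝟙 _ := by
  rw [symAction, permDelta_one, permFactors_one, vtensorMap_id]

theorem invIncl_comp_symAction {k : ℕ} (σ : Equiv.Perm (Fin k)) :
    invIncl ν U k ≫ symAction ν U k σ = invIncl ν U k := by
  rw [wideEqualizer.condition (symAction ν U k) σ 1, symAction_one, Category.comp_id]

/-- Morphisms to `U^{⊗ k} ⊗ Δ_k` fixed by `S_k` factor through the invariants. -/
noncomputable def invLift {k : ℕ} {Z : RepS ν} (z : Z ⟶ UDelta ν U k)
    (hz : ∀ σ, z ≫ symAction ν U k σ = z) : Z ⟶ invPart ν U k :=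
  wideEqualizer.lift z fun σ τ => (hz σ).trans (hz τ).symm

theorem invLift_comp_invIncl {k : ℕ} {Z : RepS ν} (z : Z ⟶ UDelta ν U k)
    (hz : ∀ σ, z ≫ symAction ν U k σ = z) : invLift ν z hz ≫ invIncl ν U k = z :=
  wideEqualizer.lift_ι _ _

theorem inv_hom_ext {k : ℕ} {Z : RepS ν} {z z' : Z ⟶ invPart ν U k}
    (h : z ≫ invIncl ν U k = z' ≫ invIncl ν U k) : z = z' :=
  wideEqualizer.hom_ext h

/-- The morphism `F_u` on invariants. -/
noncomputable def invF (u : U) (k : ℕ) : invPart ν U k ⟶ invPart ν U (k + 1) :=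
  invLift ν (invIncl ν U k ≫ opF ν u k) fun τ => by
    choose τ' h using exists_perm_succAbove τ
    rw [opF_eq, Linear.comp_smul, Linear.smul_comp, Preadditive.comp_sum, Preadditive.sum_comp]
    -- Applying τ sends the summand at `l` to the one at `τ l`, up to a permutation of the source
    -- that is trivial on invariants.
    refine congrArg _ (Fintype.sum_equiv τ _ _ fun l => ?_)
    rw [Category.assoc, insDelta_comp_symAction ν u (h l), ← Category.assoc,
      invIncl_comp_symAction]

/-- The cycle `l.cycleRange` brings `l` to position 0 and keeps the order of the others, so the
permutation it induces on the remaining k positions is the identity. Invariance under this cycle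
identifies the two contractions. -/
theorem invIncl_comp_conDelta {k : ℕ} (f : Module.Dual ℂ U) (l : Fin (k + 1)) :
    invIncl ν U (k + 1) ≫ conDelta ν f l = invIncl ν U (k + 1) ≫ conDelta ν f 0 := by
  have h := symAction_comp_conDelta ν f (τ := l.cycleRange) (τ' := 1) (l := l) (by simp)
  rw [symAction_one, Category.comp_id, Fin.cycleRange_self] at h
  rw [← h, ← Category.assoc, invIncl_comp_symAction]

theorem invIncl_comp_opE {k : ℕ} (f : Module.Dual ℂ U) :
    invIncl ν U (k + 1) ≫ opE ν f k =
      ((k : ℂ) + 1) • invIncl ν U (k + 1) ≫ conDelta ν f 0 := by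
  rw [opE_eq, Preadditive.comp_sum]
  simp only [invIncl_comp_conDelta ν f, Finset.sum_const, Finset.card_univ, Fintype.card_fin,
    ← Nat.cast_smul_eq_nsmul ℂ, Nat.cast_add, Nat.cast_one]

/-- The morphism `E_f` on invariants. -/
noncomputable def invE (f : Module.Dual ℂ U) (k : ℕ) : invPart ν U (k + 1) ⟶ invPart ν U k :=
  invLift ν (invIncl ν U (k + 1) ≫ opE ν f k) fun σ => by
    -- The permutation of k + 1 letters fixing 0 and acting as σ on the rest: its invariance
    -- upstairs gives the invariance under σ after contracting position 0.
    have h := symAction_comp_conDelta ν f (τ := Equiv.Perm.decomposeFin.symm (0, σ)) (τ' := σ)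
      (l := 0) (by simp)
    rw [Equiv.Perm.decomposeFin_symm_apply_zero] at h
    rw [invIncl_comp_opE, Linear.smul_comp, Category.assoc, ← h, ← Category.assoc,
      invIncl_comp_symAction]

/-- The morphism `∑ A^{(i)} ⊗ id` on invariants. -/
noncomputable def invA (A : Module.End ℂ U) (k : ℕ) : invPart ν U k ⟶ invPart ν U k :=
  invLift ν (invIncl ν U k ≫ opA ν A k) fun τ => by
    rw [opA_eq, Preadditive.comp_sum, Preadditive.sum_comp]
    refine Fintype.sum_equiv τ _ _ fun i => ?_
    rw [Category.assoc, actDelta_comp_symAction, ← Category.assoc, invIncl_comp_symAction]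

theorem invF_comp_invIncl (u : U) (k : ℕ) :
    invF ν u k ≫ invIncl ν U (k + 1) = invIncl ν U k ≫ opF ν u k :=
  invLift_comp_invIncl ν _ _

theorem invE_comp_invIncl (f : Module.Dual ℂ U) (k : ℕ) :
    invE ν f k ≫ invIncl ν U k = invIncl ν U (k + 1) ≫ opE ν f k :=
  invLift_comp_invIncl ν _ _

theorem invA_comp_invIncl (A : Module.End ℂ U) (k : ℕ) :
    invA ν A k ≫ invIncl ν U k = invIncl ν U k ≫ opA ν A k :=
  invLift_comp_invIncl ν _ _

theorem invF_comm (u u' : U) (k : ℕ) :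
    invF ν u k ≫ invF ν u' (k + 1) = invF ν u' k ≫ invF ν u (k + 1) := by
  apply inv_hom_ext
  rw [Category.assoc, Category.assoc, invF_comp_invIncl, invF_comp_invIncl, ← Category.assoc,
    ← Category.assoc, invF_comp_invIncl, invF_comp_invIncl, Category.assoc, Category.assoc,
    opF_comm]

theorem invE_comm (f f' : Module.Dual ℂ U) (k : ℕ) :
    invE ν f (k + 1) ≫ invE ν f' k = invE ν f' (k + 1) ≫ invE ν f k := by
  apply inv_hom_ext
  rw [Category.assoc, Category.assoc, invE_comp_invIncl, invE_comp_invIncl, ← Category.assoc,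
    ← Category.assoc, invE_comp_invIncl, invE_comp_invIncl, Category.assoc, Category.assoc,
    opE_comm]

theorem invF_comp_invA (A : Module.End ℂ U) (u : U) (k : ℕ) :
    invF ν u k ≫ invA ν A (k + 1) = invA ν A k ≫ invF ν u k + invF ν (A u) k := by
  apply inv_hom_ext
  rw [Preadditive.add_comp, Category.assoc, Category.assoc, invF_comp_invIncl, invF_comp_invIncl,
    invA_comp_invIncl, ← Category.assoc, ← Category.assoc, invF_comp_invIncl, invA_comp_invIncl,
    Category.assoc, Category.assoc, opF_comp_opA, Preadditive.comp_add]

theorem invA_comp_invE (A : Module.End ℂ U) (f : Module.Dual ℂ U) (k : ℕ) :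
    invA ν A (k + 1) ≫ invE ν f k = invE ν f k ≫ invA ν A k + invE ν (f ∘ₗ A) k := by
  apply inv_hom_ext
  rw [Preadditive.add_comp, Category.assoc, Category.assoc, invE_comp_invIncl, invE_comp_invIncl,
    invA_comp_invIncl, ← Category.assoc, ← Category.assoc, invE_comp_invIncl, invA_comp_invIncl,
    Category.assoc, Category.assoc, opA_comp_opE, Preadditive.comp_add]

theorem invA_mul (A B : Module.End ℂ U) (k : ℕ) :
    invA ν B k ≫ invA ν A k - invA ν A k ≫ invA ν B k = invA ν (A * B) k - invA ν (B * A) k := by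
  apply inv_hom_ext
  simp only [Preadditive.sub_comp, Category.assoc, invA_comp_invIncl]
  simp only [← Category.assoc, invA_comp_invIncl]
  simp only [Category.assoc, ← Preadditive.comp_sub, opA_mul]

theorem invA_id (k : ℕ) :
    invA ν (LinearMap.id : U →ₗ[ℂ] U) k = (k : ℂ) • 𝟙 (invPart ν U k) := by
  apply inv_hom_ext
  rw [invA_comp_invIncl, opA_id, Linear.comp_smul, Linear.smul_comp, Category.comp_id,
    Category.id_comp]

theorem invF_add (u u' : U) (k : ℕ) : invF ν (u + u') k = invF ν u k + invF ν u' k := by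
  apply inv_hom_ext
  simp only [Preadditive.add_comp, invF_comp_invIncl, opF_add, Preadditive.comp_add]

theorem invF_smul (c : ℂ) (u : U) (k : ℕ) : invF ν (c • u) k = c • invF ν u k := by
  apply inv_hom_ext
  simp only [Linear.smul_comp, invF_comp_invIncl, opF_smul, Linear.comp_smul]

theorem invE_add (f f' : Module.Dual ℂ U) (k : ℕ) :
    invE ν (f + f') k = invE ν f k + invE ν f' k := by
  apply inv_hom_ext
  simp only [Preadditive.add_comp, invE_comp_invIncl, opE_add, Preadditive.comp_add]

theorem invE_smul (c : ℂ) (f : Module.Dual ℂ U) (k : ℕ) : invE ν (c • f) k = c • invE ν f k := by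
  apply inv_hom_ext
  simp only [Linear.smul_comp, invE_comp_invIncl, opE_smul, Linear.comp_smul]

theorem invA_add (A B : Module.End ℂ U) (k : ℕ) :
    invA ν (A + B) k = invA ν A k + invA ν B k := by
  apply inv_hom_ext
  simp only [Preadditive.add_comp, invA_comp_invIncl, opA_add, Preadditive.comp_add]

theorem invA_smul (c : ℂ) (A : Module.End ℂ U) (k : ℕ) : invA ν (c • A) k = c • invA ν A k := by
  apply inv_hom_ext
  simp only [Linear.smul_comp, invA_comp_invIncl, opA_smul, Linear.comp_smul]

/-- The image of F_u is invariant, so E_f acts on it as k + 1 times the contraction at 0, which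
cancels the normalization of F_u. Only the position of the insertion is still summed over. -/
theorem invF_comp_invE_comp_invIncl (f : Module.Dual ℂ U) (u : U) (k : ℕ) :
    (invF ν u k ≫ invE ν f k) ≫ invIncl ν U k =
      invIncl ν U k ≫ ∑ l, insDelta ν u l ≫ conDelta ν f 0 := by
  have hk : ((k : ℂ) + 1) ≠ 0 := Nat.cast_add_one_ne_zero k
  rw [Category.assoc, invE_comp_invIncl, invIncl_comp_opE, Linear.comp_smul, ← Category.assoc,
    invF_comp_invIncl, opF_eq, Linear.comp_smul, Linear.smul_comp, smul_smul,
    mul_inv_cancel₀ hk, one_smul, Category.assoc, Preadditive.sum_comp]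

/-- Position 0 is the only place to insert, so only the scalar term occurs; the operator of T_{f,u}
is an empty sum in this degree. -/
theorem invF_comp_invE_zero (f : Module.Dual ℂ U) (u : U) :
    invF ν u 0 ≫ invE ν f 0 =
      (ν * f u) • 𝟙 (invPart ν U 0) - invA ν (f.smulRight u) 0 := by
  apply inv_hom_ext
  rw [invF_comp_invE_comp_invIncl, Preadditive.sub_comp, invA_comp_invIncl, opA_eq,
    Fin.sum_univ_succ, insDelta_comp_conDelta_self, Fin.sum_univ_zero, Fin.sum_univ_zero,
    comp_zero, sub_zero, add_zero, Nat.cast_zero, sub_zero, Linear.comp_smul, Linear.smul_comp,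
    Category.comp_id, Category.id_comp]

/-- The insertion at 0 meets the contraction and gives the scalar. The insertions at j + 1 reproduce
F_u E_f term by term, each with the correction -T_{f,u}^{(j)}. -/
theorem invF_comp_invE_succ (f : Module.Dual ℂ U) (u : U) (k : ℕ) :
    invF ν u (k + 1) ≫ invE ν f (k + 1) - invE ν f k ≫ invF ν u k =
      ((ν - ((k : ℂ) + 1)) * f u) • 𝟙 (invPart ν U (k + 1)) - invA ν (f.smulRight u) (k + 1) := by
  have hk : ((k : ℂ) + 1) ≠ 0 := Nat.cast_add_one_ne_zero k
  -- Here E_f comes first, from degree k + 1, and its factor k + 1 again cancels the 1/(k+1) of F_u,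
  -- now starting in degree k.
  have hEF : (invE ν f k ≫ invF ν u k) ≫ invIncl ν U (k + 1) =
      ∑ j, invIncl ν U (k + 1) ≫ conDelta ν f 0 ≫ insDelta ν u j := by
    rw [Category.assoc, invF_comp_invIncl, ← Category.assoc, invE_comp_invIncl, invIncl_comp_opE,
      opF_eq, Linear.comp_smul, Linear.smul_comp, smul_smul, inv_mul_cancel₀ hk, one_smul,
      Preadditive.comp_sum]
    simp only [Category.assoc]
  have hT : ∀ j : Fin (k + 1), invIncl ν U (k + 1) ≫ insDelta ν u j.succ ≫ conDelta ν f 0 =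
      invIncl ν U (k + 1) ≫ conDelta ν f 0 ≫ insDelta ν u j -
        invIncl ν U (k + 1) ≫ actDelta ν (f.smulRight u) j := by
    intro j
    rw [insDelta_succ_comp_conDelta_zero, Preadditive.comp_sub]
    congr 1
    rw [← Category.assoc, invIncl_comp_symAction]
  apply inv_hom_ext
  rw [Preadditive.sub_comp, Preadditive.sub_comp, invF_comp_invE_comp_invIncl, hEF,
    invA_comp_invIncl, Linear.smul_comp, Category.id_comp, opA_eq, Preadditive.comp_sum,
    Fin.sum_univ_succ, insDelta_comp_conDelta_self, Linear.comp_smul, Category.comp_id,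
    Preadditive.comp_sum]
  simp only [hT, Finset.sum_sub_distrib]
  push_cast
  abel

end Invariants
end DeligneSn

/-! ### Block decomposition of gl(ℂe ⊕ U) and its presentation by operators. -/

namespace DeligneSn

section Blocks

variable {V : Type*} [AddCommGroup V] [Module ℂ V] {e : V} (he : e ≠ 0) {U : Submodule ℂ V}
  (hU : IsCompl (Submodule.span ℂ {e}) U)

/-- The projection of `V = ℂ e ⊕ U` to `U`. -/
noncomputable abbrev projU : V →ₗ[ℂ] U := U.projectionOnto (Submodule.span ℂ {e}) hU.symm

theorem coordE_self : coordE he hU e = 1 := by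
  have h : (Submodule.span ℂ {e}).projectionOnto U hU e =
      ⟨e, Submodule.mem_span_singleton_self e⟩ :=
    Submodule.projectionOnto_apply_left hU ⟨e, Submodule.mem_span_singleton_self e⟩
  rw [coordE, LinearMap.comp_apply, h]
  exact LinearEquiv.coord_self ℂ V e he

theorem coordE_coe (u : U) : coordE he hU u = 0 := by
  rw [coordE, LinearMap.comp_apply, Submodule.projectionOnto_apply_right, map_zero]

theorem projU_self : projU hU e = 0 :=
  Submodule.projectionOnto_apply_right hU.symm ⟨e, Submodule.mem_span_singleton_self e⟩

theorem projU_coe (u : U) : projU hU (u : V) = u :=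
  Submodule.projectionOnto_apply_left hU.symm u

theorem coordE_smul_add_projU (v : V) : coordE he hU v • e + (projU hU v : V) = v := by
  have h : v ∈ Submodule.span ℂ {e} ⊔ U := by rw [hU.sup_eq_top]; trivial
  obtain ⟨x, hx, u, hu, rfl⟩ := Submodule.mem_sup.1 h
  obtain ⟨c, rfl⟩ := Submodule.mem_span_singleton.1 hx
  have h1 := coordE_coe he hU ⟨u, hu⟩
  have h2 := projU_coe hU ⟨u, hu⟩
  dsimp only at h1 h2
  rw [map_add, map_smul, coordE_self, h1, map_add, map_smul, projU_self, h2]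
  simp

/-- The block `ℂ e → ℂ e` of an endomorphism of `V = ℂ e ⊕ U`. -/
noncomputable def blockScalar : Module.End ℂ V →ₗ[ℂ] ℂ :=
  coordE he hU ∘ₗ LinearMap.applyₗ e

/-- The block `ℂ e → U` of an endomorphism of `V = ℂ e ⊕ U`. -/
noncomputable def blockVec : Module.End ℂ V →ₗ[ℂ] U :=
  projU hU ∘ₗ LinearMap.applyₗ e

/-- The block `U → ℂ e` of an endomorphism of `V = ℂ e ⊕ U`. -/
noncomputable def blockDual : Module.End ℂ V →ₗ[ℂ] Module.Dual ℂ U :=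
  LinearMap.llcomp ℂ U V ℂ (coordE he hU) ∘ₗ LinearMap.lcomp ℂ V U.subtype

/-- The block `U → U` of an endomorphism of `V = ℂ e ⊕ U`. -/
noncomputable def blockEnd : Module.End ℂ V →ₗ[ℂ] Module.End ℂ U :=
  LinearMap.llcomp ℂ U V U (projU hU) ∘ₗ LinearMap.lcomp ℂ V U.subtype

theorem blockScalar_apply (X : Module.End ℂ V) : blockScalar he hU X = coordE he hU (X e) := rfl
theorem blockVec_apply (X : Module.End ℂ V) : blockVec hU X = projU hU (X e) := rfl
theorem blockDual_apply (X : Module.End ℂ V) (w : U) :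
    blockDual he hU X w = coordE he hU (X w) := rfl
theorem blockEnd_apply (X : Module.End ℂ V) (w : U) : blockEnd hU X w = projU hU (X w) := rfl

theorem apply_e_eq (X : Module.End ℂ V) :
    X e = blockScalar he hU X • e + (blockVec hU X : V) :=
  (coordE_smul_add_projU he hU (X e)).symm

theorem apply_coe_eq (X : Module.End ℂ V) (w : U) :
    X w = blockDual he hU X w • e + (blockEnd hU X w : V) :=
  (coordE_smul_add_projU he hU (X w)).symm

theorem blockScalar_mul (X Y : Module.End ℂ V) : blockScalar he hU (X * Y) =
    blockScalar he hU X * blockScalar he hU Y + blockDual he hU X (blockVec hU Y) := by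
  rw [blockScalar_apply, Module.End.mul_apply, apply_e_eq he hU Y, map_add, map_smul, map_add,
    map_smul, smul_eq_mul, mul_comm]
  rfl

theorem blockVec_mul (X Y : Module.End ℂ V) : blockVec hU (X * Y) =
    blockScalar he hU Y • blockVec hU X + blockEnd hU X (blockVec hU Y) := by
  rw [blockVec_apply, Module.End.mul_apply, apply_e_eq he hU Y, map_add, map_smul, map_add,
    map_smul]
  rfl

theorem blockDual_mul (X Y : Module.End ℂ V) : blockDual he hU (X * Y) =
    blockScalar he hU X • blockDual he hU Y + blockDual he hU X ∘ₗ blockEnd hU Y := by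
  ext w
  rw [blockDual_apply, Module.End.mul_apply, apply_coe_eq he hU Y, map_add, map_smul, map_add,
    map_smul, LinearMap.add_apply, LinearMap.smul_apply, smul_eq_mul, smul_eq_mul, mul_comm]
  rfl

/-- The rank-one summand comes from the path U → ℂe → U; in a commutator it is the source of
T_{f,u}. -/
theorem blockEnd_mul (X Y : Module.End ℂ V) : blockEnd hU (X * Y) =
    (blockDual he hU Y).smulRight (blockVec hU X) + blockEnd hU X * blockEnd hU Y := by
  refine LinearMap.ext fun w => ?_
  rw [blockEnd_apply, Module.End.mul_apply, apply_coe_eq he hU Y, map_add, map_smul, map_add,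
    map_smul, LinearMap.add_apply, LinearMap.smulRight_apply]
  rfl

theorem end_hom_ext (he : e ≠ 0) (hU : IsCompl (Submodule.span ℂ {e}) U)
    {X Y : Module.End ℂ V} (h : X e = Y e) (h' : ∀ w : U, X w = Y w) :
    X = Y := by
  refine LinearMap.ext fun v => ?_
  rw [← coordE_smul_add_projU he hU v, map_add, map_add, map_smul, map_smul, h, h']

theorem lowering_e (u : U) : lowering he hU u e = u := by
  rw [lowering, LinearMap.smulRight_apply, coordE_self, one_smul]

theorem lowering_coe (u w : U) : lowering he hU u w = 0 := by
  rw [lowering, LinearMap.smulRight_apply, coordE_coe, zero_smul]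

theorem raising_e (f : Module.Dual ℂ U) : raising hU f e = 0 := by
  rw [raising, LinearMap.smulRight_apply, LinearMap.comp_apply, projU_self hU, map_zero, zero_smul]

theorem raising_coe (f : Module.Dual ℂ U) (w : U) : raising hU f w = f w • e := by
  rw [raising, LinearMap.smulRight_apply, LinearMap.comp_apply, projU_coe hU]

theorem extendEnd_e (B : Module.End ℂ U) : extendEnd hU B e = 0 := by
  rw [extendEnd, LinearMap.comp_apply, LinearMap.comp_apply, projU_self hU, map_zero, map_zero]

theorem extendEnd_coe (B : Module.End ℂ U) (w : U) : extendEnd hU B w = B w := by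
  rw [extendEnd, LinearMap.comp_apply, LinearMap.comp_apply, projU_coe hU]
  rfl

/-- The first block is written through id_V - id_U, so that a homomorphism is visibly determined by
its values on id_V, U, U^* and gl(U). -/
theorem eq_sum_blocks (X : Module.End ℂ V) :
    X = blockScalar he hU X • (LinearMap.id - extendEnd hU LinearMap.id) +
      lowering he hU (blockVec hU X) + raising hU (blockDual he hU X) +
      extendEnd hU (blockEnd hU X) := by
  refine end_hom_ext he hU ?_ fun w => ?_
  · simp [lowering_e, raising_e, extendEnd_e, ← apply_e_eq he hU X]
  · simp [lowering_coe, raising_coe, extendEnd_coe, ← apply_coe_eq he hU X]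

/-- A representation of `gl(ℂ e ⊕ U)` in which the identity acts by a scalar is given by operators
for `U`, `U^*` and `gl(U)` subject to the commutation relations. -/
theorem exists_lieHom {R : Type*} [Ring R] [Algebra ℂ R] (ν : ℂ) (F : U →ₗ[ℂ] R)
    (E : Module.Dual ℂ U →ₗ[ℂ] R) (A : Module.End ℂ U →ₗ[ℂ] R)
    (hFF : ∀ u u', F u * F u' = F u' * F u) (hEE : ∀ f f', E f * E f' = E f' * E f)
    (hEF : ∀ f u, E f * F u - F u * E f =
      f u • (ν • 1 - A LinearMap.id) - A (f.smulRight u))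
    (hAF : ∀ B u, A B * F u = F u * A B + F (B u))
    (hEA : ∀ B f, E f * A B = A B * E f + E (f ∘ₗ B))
    (hAA : ∀ B B', A B * A B' - A B' * A B = A (B * B') - A (B' * B)) :
    ∃ ρ : Module.End ℂ V →ₗ⁅ℂ⁆ R, ρ LinearMap.id = ν • 1 ∧
      (∀ u, ρ (lowering he hU u) = F u) ∧ (∀ f, ρ (raising hU f) = E f) ∧
      ∀ B, ρ (extendEnd hU B) = A B := by
  -- `P` is the forced image of the projection onto ℂe along U, which equals id_V - id_U.
  obtain ⟨P, hP⟩ : ∃ P, P = ν • 1 - A LinearMap.id := ⟨_, rfl⟩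
  rw [← hP] at hEF
  -- The scalar part of `P` is central, so every bracket with `P` comes from the degree operator `A
  -- LinearMap.id`.
  have hone : ∀ x : R, ⁅ν • (1 : R), x⁆ = 0 := fun x => by
    rw [Ring.lie_def, smul_mul_assoc, mul_smul_comm, one_mul, mul_one, sub_self]
  let L : Module.End ℂ V →ₗ[ℂ] R := (blockScalar he hU).smulRight P + F ∘ₗ blockVec hU +
    E ∘ₗ blockDual he hU + A ∘ₗ blockEnd hU
  have hL : ∀ X, L X = blockScalar he hU X • P + F (blockVec hU X) + E (blockDual he hU X) +
    A (blockEnd hU X) := fun X => rfl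
  have hFF' : ∀ u u', ⁅F u, F u'⁆ = 0 := fun u u' => by
    rw [Ring.lie_def, hFF, sub_self]
  have hEE' : ∀ u u', ⁅E u, E u'⁆ = 0 := fun u u' => by
    rw [Ring.lie_def, hEE, sub_self]
  have hEF' : ∀ f u, ⁅E f, F u⁆ = f u • P - A (f.smulRight u) := hEF
  have hFE' : ∀ f u, ⁅F u, E f⁆ = A (f.smulRight u) - f u • P := fun f u => by
    rw [← lie_skew, hEF', neg_sub]
  have hAF' : ∀ B u, ⁅A B, F u⁆ = F (B u) := fun B u => by
    rw [Ring.lie_def, hAF, add_sub_cancel_left]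
  have hFA' : ∀ B u, ⁅F u, A B⁆ = -F (B u) := fun B u => by rw [← lie_skew, hAF']
  have hEA' : ∀ B f, ⁅E f, A B⁆ = E (f ∘ₗ B) := fun B u => by
    rw [Ring.lie_def, hEA, add_sub_cancel_left]
  have hAE' : ∀ B f, ⁅A B, E f⁆ = -E (f ∘ₗ B) := fun B f => by rw [← lie_skew, hEA']
  have hAA' : ∀ B B', ⁅A B, A B'⁆ = A (B * B') - A (B' * B) := hAA
  have hPF' : ∀ u, ⁅P, F u⁆ = -F u := fun u => by
    rw [hP, sub_lie, hone, hAF', LinearMap.id_apply, zero_sub]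
  have hFP' : ∀ u, ⁅F u, P⁆ = F u := fun u => by rw [← lie_skew, hPF', neg_neg]
  have hPE' : ∀ f, ⁅P, E f⁆ = E f := fun f => by
    rw [hP, sub_lie, hone, hAE', LinearMap.comp_id, zero_sub, neg_neg]
  have hEP' : ∀ f, ⁅E f, P⁆ = -E f := fun f => by rw [← lie_skew, hPE']
  have hPA' : ∀ B, ⁅P, A B⁆ = 0 := fun B => by
    rw [hP, sub_lie, hone, hAA']
    simp [← Module.End.one_eq_id]
  have hAP' : ∀ B, ⁅A B, P⁆ = 0 := fun B => by rw [← lie_skew, hPA', neg_zero]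
  refine ⟨{ L with map_lie' := ?_ }, ?_, fun u => ?_, fun f => ?_, fun B => ?_⟩
  · intro X Y
    change L ⁅X, Y⁆ = ⁅L X, L Y⁆
    -- Both sides are expanded: the left through the block formulas for the products XY and YX, the
    -- right bilinearly into the brackets of the four types of generators.
    rw [Ring.lie_def, map_sub]
    simp only [hL, lie_add, add_lie, smul_lie, lie_smul, lie_self, hFF', hEE', hEF', hFE', hAF',
      hFA', hEA', hAE', hAA', hPF', hFP', hPE', hEP', hPA', hAP', blockScalar_mul,
      blockVec_mul he, blockDual_mul, blockEnd_mul he, map_add, map_smul]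
    module
  · change L _ = ν • 1
    have h1 : blockScalar he hU LinearMap.id = 1 := coordE_self he hU
    have h2 : blockVec hU (LinearMap.id : Module.End ℂ V) = 0 := projU_self hU
    have h3 : blockDual he hU LinearMap.id = 0 := LinearMap.ext fun w => coordE_coe he hU w
    have h4 : blockEnd hU LinearMap.id = LinearMap.id := LinearMap.ext fun w => projU_coe hU w
    simp only [hL, h1, h2, h3, h4, map_zero, add_zero, one_smul, hP, sub_add_cancel]
  · change L _ = F u
    have h1 : blockScalar he hU (lowering he hU u) = 0 := by
      rw [blockScalar_apply, lowering_e, coordE_coe]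
    have h2 : blockVec hU (lowering he hU u) = u := by
      rw [blockVec_apply, lowering_e, projU_coe]
    have h3 : blockDual he hU (lowering he hU u) = 0 := by
      ext w
      simp [blockDual_apply, lowering_coe]
    have h4 : blockEnd hU (lowering he hU u) = 0 := by
      refine LinearMap.ext fun w => ?_
      simp [blockEnd_apply, lowering_coe]
    simp only [hL, h1, h2, h3, h4, map_zero, add_zero, zero_add, zero_smul]
  · change L _ = E f
    have h1 : blockScalar he hU (raising hU f) = 0 := by
      rw [blockScalar_apply, raising_e, map_zero]
    have h2 : blockVec hU (raising hU f) = 0 := by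
      rw [blockVec_apply, raising_e, map_zero]
    have h3 : blockDual he hU (raising hU f) = f := by
      ext w
      simp [blockDual_apply, raising_coe, coordE_self]
    have h4 : blockEnd hU (raising hU f) = 0 := by
      refine LinearMap.ext fun w => ?_
      simp [blockEnd_apply, raising_coe, projU_self]
    simp only [hL, h1, h2, h3, h4, map_zero, add_zero, zero_add, zero_smul]
  · change L _ = A B
    have h1 : blockScalar he hU (extendEnd hU B) = 0 := by
      rw [blockScalar_apply, extendEnd_e, map_zero]
    have h2 : blockVec hU (extendEnd hU B) = 0 := by
      rw [blockVec_apply, extendEnd_e, map_zero]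
    have h3 : blockDual he hU (extendEnd hU B) = 0 := by
      ext w
      simp [blockDual_apply, extendEnd_coe, coordE_coe]
    have h4 : blockEnd hU (extendEnd hU B) = B := by
      refine LinearMap.ext fun w => ?_
      rw [blockEnd_apply, extendEnd_coe, projU_coe]
    simp only [hL, h1, h2, h3, h4, map_zero, zero_add, zero_smul]

end Blocks

/-! ### The operators on the coproduct and their commutation relations. -/

section EndRing

/-- Multiplication in `End` is composition of operators, opposite to the diagrammatic order; this
explains the reversed order between the relations on invariants and those below. -/
theorem comp_end_mul {D : Type*} [Category D] {X Z : D} (z : Z ⟶ X) (a b : End X) :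
    z ≫ (a * b) = (z ≫ b) ≫ a := by
  rw [End.mul_def, Category.assoc]

theorem comp_end_add {D : Type*} [Category D] [Preadditive D] {X Z : D} (z : Z ⟶ X)
    (a b : End X) : z ≫ (a + b) = z ≫ a + z ≫ b :=
  Preadditive.comp_add _ _ _ z a b

theorem comp_end_sub {D : Type*} [Category D] [Preadditive D] {X Z : D} (z : Z ⟶ X)
    (a b : End X) : z ≫ (a - b) = z ≫ a - z ≫ b :=
  Preadditive.comp_sub z a b

theorem comp_end_smul {D : Type*} [Category D] [Preadditive D] [Linear ℂ D] {X Z : D}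
    (z : Z ⟶ X) (c : ℂ) (a : End X) : z ≫ (c • a) = c • z ≫ a :=
  Linear.comp_smul _ _ _ z c a

end EndRing

section Coproduct

variable (ν : ℂ) {U : Type*} [AddCommGroup U] [Module ℂ U] [Module.Finite ℂ U]

/-- The action of `u ∈ U` on the complex tensor power. -/
noncomputable def cpowF (u : U) : End (cpow ν U) :=
  Sigma.desc fun k => Ind.yoneda.map (invF ν u k) ≫ cpowIncl ν U (k + 1)

/-- The action of `f ∈ U^*` on the complex tensor power. -/
noncomputable def cpowE (f : Module.Dual ℂ U) : End (cpow ν U) :=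
  Sigma.desc fun
    | 0 => 0
    | k + 1 => Ind.yoneda.map (invE ν f k) ≫ cpowIncl ν U k

/-- The action of `A ∈ gl(U)` on the complex tensor power. -/
noncomputable def cpowA (A : Module.End ℂ U) : End (cpow ν U) :=
  Sigma.desc fun k => Ind.yoneda.map (invA ν A k) ≫ cpowIncl ν U k

theorem cpow_hom_ext {Z : Ind (RepS ν)} {a b : cpow ν U ⟶ Z}
    (h : ∀ k, cpowIncl ν U k ≫ a = cpowIncl ν U k ≫ b) : a = b :=
  Sigma.hom_ext _ _ h

theorem cpowIncl_cpowF (u : U) (k : ℕ) : cpowIncl ν U k ≫ cpowF ν u =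
    Ind.yoneda.map (invF ν u k) ≫ cpowIncl ν U (k + 1) :=
  Sigma.ι_desc _ _

theorem cpowIncl_cpowE_zero (f : Module.Dual ℂ U) : cpowIncl ν U 0 ≫ cpowE ν f = 0 :=
  Sigma.ι_desc _ _

theorem cpowIncl_cpowE_succ (f : Module.Dual ℂ U) (k : ℕ) : cpowIncl ν U (k + 1) ≫ cpowE ν f =
    Ind.yoneda.map (invE ν f k) ≫ cpowIncl ν U k :=
  Sigma.ι_desc _ _

theorem cpowIncl_cpowA (A : Module.End ℂ U) (k : ℕ) : cpowIncl ν U k ≫ cpowA ν A =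
    Ind.yoneda.map (invA ν A k) ≫ cpowIncl ν U k :=
  Sigma.ι_desc _ _

theorem cpowF_comm (u u' : U) : cpowF ν u * cpowF ν u' = cpowF ν u' * cpowF ν u := by
  refine cpow_hom_ext ν fun k => ?_
  simp only [comp_end_mul, cpowIncl_cpowF]
  simp only [Category.assoc, cpowIncl_cpowF]
  simp only [← Category.assoc, ← Functor.map_comp, invF_comm ν u u']

theorem cpowE_comm (f f' : Module.Dual ℂ U) :
    cpowE ν f * cpowE ν f' = cpowE ν f' * cpowE ν f := by
  refine cpow_hom_ext ν fun k => ?_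
  rw [comp_end_mul, comp_end_mul]
  rcases k with _ | _ | k
  · rw [cpowIncl_cpowE_zero, cpowIncl_cpowE_zero, zero_comp, zero_comp]
  · rw [cpowIncl_cpowE_succ, cpowIncl_cpowE_succ, Category.assoc, Category.assoc,
      cpowIncl_cpowE_zero, cpowIncl_cpowE_zero, comp_zero, comp_zero]
  · rw [cpowIncl_cpowE_succ, cpowIncl_cpowE_succ, Category.assoc, Category.assoc,
      cpowIncl_cpowE_succ, cpowIncl_cpowE_succ, ← Category.assoc, ← Category.assoc,
      ← Functor.map_comp, ← Functor.map_comp, invE_comm ν f f']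

theorem cpowA_mul (A B : Module.End ℂ U) :
    cpowA ν A * cpowA ν B - cpowA ν B * cpowA ν A = cpowA ν (A * B) - cpowA ν (B * A) := by
  refine cpow_hom_ext ν fun k => ?_
  simp only [comp_end_sub, comp_end_mul, cpowIncl_cpowA]
  simp only [Category.assoc, cpowIncl_cpowA]
  simp only [← Category.assoc, ← Functor.map_comp, ← Preadditive.sub_comp, ← Functor.map_sub,
    invA_mul ν A B]

theorem cpowA_mul_cpowF (A : Module.End ℂ U) (u : U) :
    cpowA ν A * cpowF ν u = cpowF ν u * cpowA ν A + cpowF ν (A u) := by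
  refine cpow_hom_ext ν fun k => ?_
  simp only [comp_end_add, comp_end_mul, cpowIncl_cpowA, cpowIncl_cpowF]
  simp only [Category.assoc, cpowIncl_cpowA, cpowIncl_cpowF]
  simp only [← Category.assoc, ← Functor.map_comp, ← Preadditive.add_comp, ← Functor.map_add,
    invF_comp_invA]

theorem cpowE_mul_cpowA (A : Module.End ℂ U) (f : Module.Dual ℂ U) :
    cpowE ν f * cpowA ν A = cpowA ν A * cpowE ν f + cpowE ν (f ∘ₗ A) := by
  refine cpow_hom_ext ν fun k => ?_
  simp only [comp_end_add, comp_end_mul, cpowIncl_cpowA]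
  rcases k with _ | k
  · simp only [Category.assoc, cpowIncl_cpowE_zero, comp_zero, zero_comp, add_zero]
  · simp only [Category.assoc, cpowIncl_cpowA, cpowIncl_cpowE_succ]
    simp only [← Category.assoc, ← Functor.map_comp, ← Preadditive.add_comp, ← Functor.map_add,
      invA_comp_invE]

/-- This is the action of the projection onto ℂe: the scalar ν minus the degree. -/
theorem cpowIncl_sub_cpowA_id (k : ℕ) :
    cpowIncl ν U k ≫ (ν • (1 : End (cpow ν U)) - cpowA ν LinearMap.id) =
      (ν - k) • cpowIncl ν U k := by
  rw [comp_end_sub, comp_end_smul, cpowIncl_cpowA, invA_id, Functor.map_smul, CategoryTheory.Functor.map_id,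
    Linear.smul_comp, End.one_def, Category.comp_id, Category.id_comp, sub_smul]

/-- Writing the degree-dependent scalar ν - k through the degree operator makes the commutator
formula uniform in k, in the form required by `exists_lieHom`. -/
theorem cpowE_mul_cpowF (f : Module.Dual ℂ U) (u : U) :
    cpowE ν f * cpowF ν u - cpowF ν u * cpowE ν f =
      f u • (ν • (1 : End (cpow ν U)) - cpowA ν LinearMap.id) - cpowA ν (f.smulRight u) := by
  refine cpow_hom_ext ν fun k => ?_
  have h1 : cpowIncl ν U k ≫ (cpowE ν f * cpowF ν u) =
      Ind.yoneda.map (invF ν u k ≫ invE ν f k) ≫ cpowIncl ν U k := by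
    rw [comp_end_mul, cpowIncl_cpowF, Category.assoc, cpowIncl_cpowE_succ,
      Functor.map_comp, Category.assoc]
  -- Scalars on a summand come from scalars on the invariants, so the claim reduces to an identity
  -- before ind-completion.
  have h2 : ∀ c : ℂ, Ind.yoneda.map (c • 𝟙 (invPart ν U k)) ≫ cpowIncl ν U k =
      c • cpowIncl ν U k := fun c => by
    rw [Functor.map_smul, CategoryTheory.Functor.map_id, Linear.smul_comp, Category.id_comp]
  rw [comp_end_sub, comp_end_sub, h1, comp_end_smul, cpowIncl_sub_cpowA_id,
    cpowIncl_cpowA, smul_smul, mul_comm, ← h2, ← Preadditive.sub_comp, ← Functor.map_sub]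
  -- In degree 0 the product F_u E_f vanishes because E_f is zero there; only in positive degrees
  -- does it contribute a second term.
  rcases k with _ | k
  · rw [comp_end_mul, cpowIncl_cpowE_zero, zero_comp, sub_zero,
      invF_comp_invE_zero, Nat.cast_zero, sub_zero]
  · have h3 : cpowIncl ν U (k + 1) ≫ (cpowF ν u * cpowE ν f) =
        Ind.yoneda.map (invE ν f k ≫ invF ν u k) ≫ cpowIncl ν U (k + 1) := by
      rw [comp_end_mul, cpowIncl_cpowE_succ, Category.assoc, cpowIncl_cpowF,
        Functor.map_comp, Category.assoc]
    rw [h3, ← Preadditive.sub_comp, ← Functor.map_sub, invF_comp_invE_succ, Nat.cast_add,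
      Nat.cast_one]

theorem cpowF_add (u u' : U) : cpowF ν (u + u') = cpowF ν u + cpowF ν u' :=
  cpow_hom_ext ν fun k => by
    simp only [comp_end_add, cpowIncl_cpowF, invF_add, Functor.map_add,
      Preadditive.add_comp]

theorem cpowF_smul (c : ℂ) (u : U) : cpowF ν (c • u) = c • cpowF ν u :=
  cpow_hom_ext ν fun k => by
    simp only [comp_end_smul, cpowIncl_cpowF, invF_smul, Functor.map_smul, Linear.smul_comp]

theorem cpowA_add (A B : Module.End ℂ U) : cpowA ν (A + B) = cpowA ν A + cpowA ν B :=
  cpow_hom_ext ν fun k => by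
    simp only [comp_end_add, cpowIncl_cpowA, invA_add, Functor.map_add,
      Preadditive.add_comp]

theorem cpowA_smul (c : ℂ) (A : Module.End ℂ U) : cpowA ν (c • A) = c • cpowA ν A :=
  cpow_hom_ext ν fun k => by
    simp only [comp_end_smul, cpowIncl_cpowA, invA_smul, Functor.map_smul, Linear.smul_comp]

theorem cpowE_add (f f' : Module.Dual ℂ U) : cpowE ν (f + f') = cpowE ν f + cpowE ν f' := by
  refine cpow_hom_ext ν fun k => ?_
  rcases k with _ | k
  · simp only [comp_end_add, cpowIncl_cpowE_zero, add_zero]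
  · simp only [comp_end_add, cpowIncl_cpowE_succ, invE_add, Functor.map_add,
      Preadditive.add_comp]

theorem cpowE_smul (c : ℂ) (f : Module.Dual ℂ U) : cpowE ν (c • f) = c • cpowE ν f := by
  refine cpow_hom_ext ν fun k => ?_
  rcases k with _ | k
  · simp only [comp_end_smul, cpowIncl_cpowE_zero, smul_zero]
  · simp only [comp_end_smul, cpowIncl_cpowE_succ, invE_smul, Functor.map_smul,
      Linear.smul_comp]

end Coproduct
end DeligneSn

theorem mainTheorem7 (ν : ℂ) {V : Type*} [AddCommGroup V] [Module ℂ V] [FiniteDimensional ℂ V]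
    (e : V) (he : e ≠ 0) (U : Submodule ℂ V) (hU : IsCompl (Submodule.span ℂ {e}) U) :
    -- the operators preserve the invariants
    ∃ (F : ∀ k : ℕ, U → (invPart ν U k ⟶ invPart ν U (k + 1)))
      (E : ∀ k : ℕ, Module.Dual ℂ U → (invPart ν U (k + 1) ⟶ invPart ν U k))
      (A : ∀ k : ℕ, Module.End ℂ U → (invPart ν U k ⟶ invPart ν U k)),
      (∀ k u, F k u ≫ invIncl ν U (k + 1) = invIncl ν U k ≫ opF ν u k) ∧
      (∀ k f, E k f ≫ invIncl ν U k = invIncl ν U (k + 1) ≫ opE ν f k) ∧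
      (∀ k B, A k B ≫ invIncl ν U k = invIncl ν U k ≫ opA ν B k) ∧
      -- the commutator of `E_f` and `F_u` in degrees `0` and `k + 1`
      (∀ f u, F 0 u ≫ E 0 f = (ν * f u) • 𝟙 (invPart ν U 0) - A 0 (f.smulRight u)) ∧
      (∀ k f u, F (k + 1) u ≫ E (k + 1) f - E k f ≫ F k u =
        ((ν - ((k : ℂ) + 1)) * f u) • 𝟙 (invPart ν U (k + 1)) - A (k + 1) (f.smulRight u)) ∧
      -- the action of `gl(V)`
      ∃! ρ : Module.End ℂ V →ₗ⁅ℂ⁆ End (cpow ν U),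
        ρ LinearMap.id = ν • 𝟙 (cpow ν U) ∧
        (∀ k u, cpowIncl ν U k ≫ ρ (lowering he hU u) =
          Ind.yoneda.map (F k u) ≫ cpowIncl ν U (k + 1)) ∧
        (∀ f, cpowIncl ν U 0 ≫ ρ (raising hU f) = 0) ∧
        (∀ k f, cpowIncl ν U (k + 1) ≫ ρ (raising hU f) =
          Ind.yoneda.map (E k f) ≫ cpowIncl ν U k) ∧
        (∀ k B, cpowIncl ν U k ≫ ρ (extendEnd hU B) =
          Ind.yoneda.map (A k B) ≫ cpowIncl ν U k) := by
  refine ⟨fun k u => invF ν u k, fun k f => invE ν f k, fun k B => invA ν B k,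
    fun k u => invF_comp_invIncl ν u k, fun k f => invE_comp_invIncl ν f k,
    fun k B => invA_comp_invIncl ν B k, fun f u => invF_comp_invE_zero ν f u,
    fun k f u => invF_comp_invE_succ ν f u k, ?_⟩
  obtain ⟨ρ, h1, hF, hE, hA⟩ := exists_lieHom he hU (R := End (cpow ν U)) ν
    ⟨⟨cpowF ν, cpowF_add ν⟩, cpowF_smul ν⟩ ⟨⟨cpowE ν, cpowE_add ν⟩, cpowE_smul ν⟩
    ⟨⟨cpowA ν, cpowA_add ν⟩, cpowA_smul ν⟩ (cpowF_comm ν) (cpowE_comm ν) (cpowE_mul_cpowF ν)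
    (cpowA_mul_cpowF ν) (cpowE_mul_cpowA ν) (cpowA_mul ν)
  refine ⟨ρ, ⟨h1, fun k u => ?_, fun f => ?_, fun k f => ?_, fun k B => ?_⟩, ?_⟩
  · rw [hF]; exact cpowIncl_cpowF ν u k
  · rw [hE]; exact cpowIncl_cpowE_zero ν f
  · rw [hE]; exact cpowIncl_cpowE_succ ν f k
  · rw [hA]; exact cpowIncl_cpowA ν B k
  · rintro ρ' ⟨h1', hF', hE0', hE', hA'⟩
    -- An endomorphism of the coproduct is determined on the summands, so the prescribed formulas
    -- fix the images of U, U^* and gl(U). With the image of id_V they fix the homomorphism, by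
    -- `eq_sum_blocks`.
    have eF : ∀ u, ρ' (lowering he hU u) = ρ (lowering he hU u) := fun u =>
      cpow_hom_ext ν fun k => by rw [hF', hF]; exact (cpowIncl_cpowF ν u k).symm
    have eE : ∀ f, ρ' (raising hU f) = ρ (raising hU f) := fun f =>
      cpow_hom_ext ν fun k => by
        rcases k with _ | k
        · rw [hE0', hE]; exact (cpowIncl_cpowE_zero ν f).symm
        · rw [hE', hE]; exact (cpowIncl_cpowE_succ ν f k).symm
    have eA : ∀ B, ρ' (extendEnd hU B) = ρ (extendEnd hU B) := fun B =>
      cpow_hom_ext ν fun k => by rw [hA', hA]; exact (cpowIncl_cpowA ν B k).symm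
    ext X : 1
    rw [eq_sum_blocks he hU X]
    simp only [map_add, map_smul, map_sub, eF, eE, eA, h1']
    rw [h1]
    rfl
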